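/- **Conventions.** For a topological space $X$, the *degree of compactness* $k(X)$ is the least cardinal $m$ such that every open cover of $X$ has an open refinement (again a cover) of cardinality $<m$; $w(X)$ is the weight (the least cardinality of a base); $\dim$ is covering dimension. Put $\omega(X)=\bigcup\{U: U \text{ open in } X,\ \dim U=0\}$ and $c\omega(X)=X\setminus\omega(X)$. "Paracompact" includes Hausdorff. An infinite cardinal is *sequential* if it is the supremum of countably many strictly smaller cardinals. A *set-valued mapping* $\theta:X\to Y$ assigns to each $x\in X$ a non-empty set $\theta(x)\subseteq Y$; for $A\subseteq X$, $B\subseteq Y$ put $\theta(A)=\bigcup_{x\in A}\theta(x)$, $\theta^{-1}(B)=\{x:\theta(x)\cap B\ne\emptyset\}$, $\theta^1(A)=\theta(A)$, $\theta^{n+1}(A)=\theta(\theta^{-1}(\theta^n(A)))$, $\theta^\infty(A)=\bigcup_{n\ge1}\theta^n(A)$, $\theta^\infty(x)=\theta^\infty(\{x\})$. $\theta$ is lower (upper) semi-continuous, lsc (usc), if $\theta^{-1}(H)$ is open (closed) for every open (closed) $H\subseteq Y$. A set-valued mapping $\varphi$ with $\varphi(x)\subseteq\theta(x)$ for all $x\in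 X$ is a *selection* of $\theta$; a single-valued selection is a (not necessarily continuous) function $g:X\to Y$ with $g(x)\in\theta(x)$ for all $x\in X$. **Theorem 3.1.** Let $X$ be a $T_1$-space and $\tau$ an uncountable non-sequential cardinal. The following are equivalent: 1. $X$ is paracompact and $k(c\omega(X))\le\tau$. 2. $X$ is paracompact and every lsc closed-valued mapping $\theta:X\to Y$ into a complete metrizable space $Y$ has an lsc selection $\varphi$ with $w(\varphi(c\omega(X)))<\tau$. 3. $X$ is paracompact and every lsc closed-valued mapping $\theta:X\to Y$ into a complete metrizable space $Y$ has a single-valued selection $g$ with $w(g(c\omega(X)))<\tau$. 4. $X$ is paracompact and every lsc mapping $\theta:X\to Y$ into a discrete space $Y$ has a single-valued selection $g$ with $|g(c\omega(X))|<\tau$. 5. For every lsc closed-valued mapping $\theta:X\to Y$ into a complete metrizable space $Y$ there are a compact-valued lsc mapping $\varphi:X\to Y$ and a compact-valued usc mapping $\psi:X\to Y$ such that $w(\psi(c\omega(X)))<\tau$ and $\varphi(x)\subseteq\psi(x)\subseteq\theta(x)$ for every $x\in X$. 5′. $X$ is paracompact and for every lsc closed-valued mapping $\theta:X\to Y$ into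 a complete metrizable space $Y$ there are a compact-valued lsc mapping $\varphi:X\to Y$ and a compact-valued usc mapping $\psi:X\to Y$ such that $w(\psi(X))<\tau$ and $\varphi(x)\subseteq\psi(x)\subseteq\theta(x)$ for every $x\in c\omega(X)$. 6. For every lsc closed-valued mapping $\theta:X\to Y$ into a complete metric space $Y$ there are a closed $G_\delta$-set $H$ of $X$ and a usc compact-valued selection $\psi$ of $\theta$ such that (i) $c\omega(X)\subseteq H$ and $w(\psi(H))<\tau$; (ii) $\psi(x)$ is a one-point set for every $x\in X\setminus H$; (iii) $\mathrm{cl}_Y\,\psi(H)=\mathrm{cl}_Y\,\psi(c\omega(X))$. 7. Every lsc closed-valued mapping $\theta:X\to Y$ into a complete metric space $Y$ has a usc compact-valued selection $\psi$ with $k(\psi^\infty(x))\le\tau$ for every $x\in X$. 8. Every lsc mapping $\theta:X\to Y$ into a discrete space $Y$ has a usc selection $\psi$ with $|\psi^\infty(x)|<\tau$ for every $x\in X$. Moreover, if $\tau$ is a limit cardinal, these assertions are also equivalent to assertion 7 with $k(\psi^\infty(x))<\tau$ in place of $k(\psi^\infty(x))\le\tau$. -/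

import Mathlib

open Set
open scoped Cardinal

universe u

namespace SelTop

section Covers

/-- `𝒰` is an open cover of `X`. -/
def IsOpenCover {X : Type u} [TopologicalSpace X] (𝒰 : Set (Set X)) : Prop :=
  (∀ U ∈ 𝒰, IsOpen U) ∧ ⋃₀ 𝒰 = univ

/-- Every member of `𝒱` lies in a member of `𝒰`. -/
def Refines {X : Type u} (𝒱 𝒰 : Set (Set X)) : Prop :=
  ∀ V ∈ 𝒱, ∃ U ∈ 𝒰, V ⊆ U

/-- The degree of compactness `k(X)`: the least cardinal `m` such that every open cover of `X`
has an open refinement (again a cover) of cardinality `< m`. -/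
noncomputable def compactnessDegree (X : Type u) [TopologicalSpace X] : Cardinal.{u} :=
  sInf {m | ∀ 𝒰 : Set (Set X), IsOpenCover 𝒰 →
    ∃ 𝒱 : Set (Set X), IsOpenCover 𝒱 ∧ Refines 𝒱 𝒰 ∧ #𝒱 < m}

/-- The weight `w(X)`: the least cardinality of a base of `X`. -/
noncomputable def weight (X : Type u) [TopologicalSpace X] : Cardinal.{u} :=
  sInf {m | ∃ B : Set (Set X), TopologicalSpace.IsTopologicalBasis B ∧ #B = m}

/-- The covering dimension of `X` is at most `d`: every finite open cover has a finite open
refinement such that every point lies in at most `d + 1` of its members.  For `d = ⊥` (that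
is, `-1`) this says that `X` is empty. -/
def CoveringDimLE (X : Type u) [TopologicalSpace X] (d : WithBot ℕ∞) : Prop :=
  ∀ 𝒰 : Set (Set X), 𝒰.Finite → IsOpenCover 𝒰 →
    ∃ 𝒱 : Set (Set X), 𝒱.Finite ∧ IsOpenCover 𝒱 ∧ Refines 𝒱 𝒰 ∧
      ∀ x : X, (({V ∈ 𝒱 | x ∈ V}.encard : ℕ∞) : WithBot ℕ∞) ≤ d + 1

/-- The covering dimension `dim X`, with value `⊥` for the empty space. -/
noncomputable def coveringDim (X : Type u) [TopologicalSpace X] : WithBot ℕ∞ :=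
  sInf {d | CoveringDimLE X d}

/-- `ω(X)`: the union of all open subspaces `U` with `dim U = 0`. -/
def zeroDimPart (X : Type u) [TopologicalSpace X] : Set X :=
  ⋃₀ {U : Set X | IsOpen U ∧ coveringDim U = 0}

/-- The cozero-dimensional kernel `cω(X) = X \ ω(X)`. -/
def cozeroKernel (X : Type u) [TopologicalSpace X] : Set X :=
  (zeroDimPart X)ᶜ

end Covers

/-- A cardinal is sequential if it is the supremum of a sequence of strictly smaller
cardinals; for an infinite cardinal this means that its cofinality is `ℵ₀`. -/
def IsSequential (τ : Cardinal.{u}) : Prop :=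
  ∃ f : ℕ → Cardinal.{u}, (∀ n, f n < τ) ∧ ⨆ n, f n = τ

/-- A set-valued mapping assigns to every point a non-empty subset of the target. -/
structure SetValuedMap (X Y : Type u) where
  toFun : X → Set Y
  nonempty' : ∀ x, (toFun x).Nonempty

namespace SetValuedMap

variable {X Y : Type u}

instance : CoeFun (SetValuedMap X Y) (fun _ => X → Set Y) := ⟨toFun⟩

/-- `θ(A) = ⋃ {θ(x) : x ∈ A}`. -/
def image (θ : SetValuedMap X Y) (A : Set X) : Set Y := ⋃ x ∈ A, θ x

/-- `θ⁻¹(B) = {x : θ(x) ∩ B ≠ ∅}`. -/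
def preimage (θ : SetValuedMap X Y) (B : Set Y) : Set X := {x | (θ x ∩ B).Nonempty}

/-- `θ.iterImage A n` is the `(n + 1)`-image of `A`, where the first image is `θ(A)` and the
`(n + 1)`-image is `θ(θ⁻¹(·))` of the `n`-image. -/
def iterImage (θ : SetValuedMap X Y) (A : Set X) : ℕ → Set Y
  | 0 => θ.image A
  | n + 1 => θ.image (θ.preimage (θ.iterImage A n))

/-- The largest image `θ^∞(A)`, the union of all `n`-images with `n ≥ 1`. -/
def largestImage (θ : SetValuedMap X Y) (A : Set X) : Set Y := ⋃ n, θ.iterImage A n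

/-- `φ` is a selection of `θ`. -/
def IsSelection (φ θ : SetValuedMap X Y) : Prop := ∀ x, φ x ⊆ θ x

/-- `g` is a single-valued selection of `θ`. -/
def IsSingleValuedSelection (g : X → Y) (θ : SetValuedMap X Y) : Prop := ∀ x, g x ∈ θ x

/-- Lower semi-continuity. -/
def IsLSC [TopologicalSpace X] [TopologicalSpace Y] (θ : SetValuedMap X Y) : Prop :=
  LowerHemicontinuous θ.toFun

/-- Upper semi-continuity. -/
def IsUSC [TopologicalSpace X] [TopologicalSpace Y] (θ : SetValuedMap X Y) : Prop :=
  UpperHemicontinuous θ.toFun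

/-- Lower semi-continuity means that preimages of open sets are open. -/
theorem isLSC_iff [TopologicalSpace X] [TopologicalSpace Y] (θ : SetValuedMap X Y) :
    θ.IsLSC ↔ ∀ H : Set Y, IsOpen H → IsOpen (θ.preimage H) := by
  unfold IsLSC
  simp only [LowerHemicontinuous, lowerHemicontinuous_iff, lowerHemicontinuousAt_iff]
  constructor
  · intro h H hH
    exact isOpen_iff_eventually.2 fun x hx => h x H hH hx
  · intro h x H hH hx
    exact isOpen_iff_eventually.1 (h H hH) x hx

/-- Upper semi-continuity means that preimages of closed sets are closed. -/
theorem isUSC_iff [TopologicalSpace X] [TopologicalSpace Y] (θ : SetValuedMap X Y) :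
    θ.IsUSC ↔ ∀ H : Set Y, IsClosed H → IsClosed (θ.preimage H) := by
  unfold IsUSC
  simp only [upperHemicontinuous_iff, upperHemicontinuousAt_iff_forall_isOpen]
  have key : ∀ (H : Set Y) (x : X), x ∈ (θ.preimage H)ᶜ ↔ θ.toFun x ⊆ Hᶜ := by
    intro H x
    simp only [preimage, mem_compl_iff, mem_ofPred_eq, Set.not_nonempty_iff_eq_empty]
    rw [← Set.disjoint_iff_inter_eq_empty, Set.subset_compl_iff_disjoint_right]
  constructor
  · intro h H hH
    rw [← isOpen_compl_iff]
    refine isOpen_iff_eventually.2 fun x hx => ?_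
    filter_upwards [h x Hᶜ hH.isOpen_compl ((key H x).1 hx)] with z hz
    exact (key H z).2 hz
  · intro h x u hu hx
    have h1 := (h uᶜ hu.isClosed_compl).isOpen_compl
    have h2 : x ∈ (θ.preimage uᶜ)ᶜ := (key uᶜ x).2 (by rwa [compl_compl])
    filter_upwards [isOpen_iff_eventually.1 h1 x h2] with z hz
    have h3 := (key uᶜ z).1 hz
    rwa [compl_compl] at h3

/-- All values are closed. -/
def ClosedValued [TopologicalSpace Y] (θ : SetValuedMap X Y) : Prop := ∀ x, IsClosed (θ x)

/-- All values are compact. -/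
def CompactValued [TopologicalSpace Y] (θ : SetValuedMap X Y) : Prop := ∀ x, IsCompact (θ x)

end SetValuedMap

end SelTop

open SelTop

/-!
# Selections and the cozero-dimensional kernel

Let `K` be the cozero-dimensional kernel of `X`.

Suppose first that `X` is paracompact and `K` has degree of compactness at most `τ`.  Everything is
extracted from one pair of selections `φ ⊆ ψ ⊆ θ` provided by Michael's theorem
(`exists_lsc_usc_selection`), with compact-valued `φ` lower and `ψ` upper semi-continuous.  For any
such `ψ` the set `ψ(K)` inherits the small degree of compactness of `K`; at each of countably many
scales it is covered by fewer than `τ` balls, and since `τ` is uncountable and not sequential it has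
a dense set of size less than `τ` (`exists_mk_lt_image_subset_closure`).  To make `ψ` single-valued
off a closed `Gδ`-set `H`, one uses that closed sets disjoint from `K` are covered by disjoint
clopen sets refining any open cover (`exists_disjoint_isClopen_refinement`).  Hence `K` has a base
of clopen neighbourhoods, and the complement of the intersection `H` of countably many of them has
continuous selections; there `ψ` is replaced by a continuous selection of `φ`.  As the new mapping
lies below `ψ`, it is still upper semi-continuous (`exists_usc_selection_single_valued_off`).  For a
mapping that is single-valued off `H`, a largest image is a point or a subset of the image of `H`.

Conversely, upper semi-continuous selections of mappings into discrete spaces refine open covers by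
closure-preserving closed covers, which by Michael's criterion gives paracompactness
(`HasClosurePreservingRefinements.paracompactSpace`).  If `K` were not of degree of compactness at
most `τ`, it would contain a closed discrete set `D` of size at least `τ`
(`compactnessDegree_le_of_forall_discrete`).  No point of `D` has a neighbourhood of dimension
zero, so near each `d` there are disjoint closed sets that no clopen set separates
(`mem_zeroDimPart_of_clopen_separation`).  Prescribing the value `none` on one of them and `some d`
on the other links `none` to every `some d`, and a single largest image has size at least `τ`
(`mk_lt_of_usc_selection`).
-/

/-! ### Closure-preserving closed refinements and paracompactness -/

/-- Every indexed open cover of `X` has a precise closed refinement that is closure-preserving: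
the union of every subfamily is closed. -/
def HasClosurePreservingRefinements (X : Type u) [TopologicalSpace X] : Prop :=
  ∀ (S : Type u) (U : S → Set X), (∀ s, IsOpen (U s)) → ⋃ s, U s = univ →
    ∃ F : S → Set X, (∀ T : Set S, IsClosed (⋃ s ∈ T, F s)) ∧ (∀ s, F s ⊆ U s) ∧
      ⋃ s, F s = univ

namespace HasClosurePreservingRefinements

variable {X : Type u} [TopologicalSpace X]

theorem normalSpace (h : HasClosurePreservingRefinements X) : NormalSpace X := by
  refine ⟨fun A B hA hB hAB => ?_⟩
  obtain ⟨F, hF, hFU, hcov⟩ := h (ULift Bool) (fun b => if b.down then Aᶜ else Bᶜ)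
    (fun b => by
      by_cases hb : b.down
      · simpa [hb] using hA.isOpen_compl
      · simpa [hb] using hB.isOpen_compl)
    (by
      refine eq_univ_of_forall fun x => mem_iUnion.2 ?_
      by_cases hx : x ∈ A
      · exact ⟨⟨false⟩, by simpa using fun hb => hAB.le_bot ⟨hx, hb⟩⟩
      · exact ⟨⟨true⟩, by simpa using hx⟩)
  have hF1 : ∀ b, IsClosed (F b) := fun b => by simpa using hF {b}
  refine ⟨(F ⟨true⟩)ᶜ, (F ⟨false⟩)ᶜ, (hF1 _).isOpen_compl, (hF1 _).isOpen_compl, ?_, ?_, ?_⟩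
  · intro x hx hx'
    simpa [hx] using hFU _ hx'
  · intro x hx hx'
    simpa [hx] using hFU _ hx'
  · rw [Set.disjoint_iff]
    rintro x ⟨h1, h2⟩
    have hx : x ∈ ⋃ s, F s := hcov ▸ mem_univ x
    obtain ⟨⟨b⟩, hb⟩ := mem_iUnion.1 hx
    cases b
    · exact h2 hb
    · exact h1 hb

/-- Well-order the index set and take closure-preserving closed covers `F₀, F₁, …` with
`F (i + 1) s` disjoint from `F i t` for `t < s`.  The least index whose member of `F i` contains a
given point does not increase with `i`, and once it is stationary the point lies in only one
member. -/
theorem exists_sigma_disjoint (h : HasClosurePreservingRefinements X) {S : Type u}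
    (U : S → Set X) (hU : ∀ s, IsOpen (U s)) (hcov : ⋃ s, U s = univ) :
    ∃ V : ℕ → S → Set X, (∀ i s, IsOpen (V i s)) ∧ (∀ i s, V i s ⊆ U s) ∧
      (∀ x, ∃ i s, x ∈ V i s) ∧ ∀ i s t, s ≠ t → Disjoint (V i s) (V i t) := by
  obtain ⟨_, hwf⟩ := exists_wellFoundedLT S
  let P : (S → Set X) → Prop := fun F =>
    (∀ T : Set S, IsClosed (⋃ s ∈ T, F s)) ∧ (∀ s, F s ⊆ U s) ∧ ⋃ s, F s = univ
  obtain ⟨F₀, hF₀⟩ := h S U hU hcov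
  have step : ∀ F, P F → ∃ F', P F' ∧ ∀ s t, t < s → Disjoint (F' s) (F t) := by
    rintro F ⟨hF, hFU, hFc⟩
    obtain ⟨F', hF', hFU', hFc'⟩ := h S (fun s => U s \ ⋃ t ∈ Iio s, F t)
      (fun s => (hU s).sdiff (hF _))
      (by
        refine eq_univ_of_forall fun x => mem_iUnion.2 ?_
        have hne : {s | x ∈ U s}.Nonempty := by
          have : x ∈ ⋃ s, U s := hcov ▸ mem_univ x
          exact mem_iUnion.1 this
        refine ⟨hwf.wf.min _ hne, hwf.wf.min_mem _ hne, ?_⟩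
        simp only [mem_iUnion, not_exists]
        intro t ht hxt
        exact hwf.wf.not_lt_min _ (hFU t hxt : t ∈ {s | x ∈ U s}) ht)
    refine ⟨F', ⟨hF', fun s => (hFU' s).trans sdiff_subset, hFc'⟩, fun s t hts => ?_⟩
    rw [Set.disjoint_left]
    intro x hx hxt
    exact (hFU' s hx).2 (mem_biUnion (show t ∈ Iio s from hts) hxt)
  choose! nxt hnxt hdis using step
  let F : ℕ → S → Set X := fun n => nxt^[n] F₀
  have hsucc : ∀ n, F (n + 1) = nxt (F n) := fun n => Function.iterate_succ_apply' nxt n F₀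
  have hP : ∀ n, P (F n) := by
    intro n
    induction n with
    | zero => exact hF₀
    | succ n ih => rw [hsucc]; exact hnxt _ ih
  have hd : ∀ n s t, t < s → Disjoint (F (n + 1) s) (F n t) := fun n => by
    rw [hsucc]; exact hdis _ (hP n)
  have hmem : ∀ n x, ∃ s, x ∈ F n s := fun n x => by
    have : x ∈ ⋃ s, F n s := (hP n).2.2 ▸ mem_univ x
    exact mem_iUnion.1 this
  have hVF : ∀ i s, (⋃ t ∈ ({s}ᶜ : Set S), F i t)ᶜ ⊆ F i s := by
    intro i s x hx
    obtain ⟨t, ht⟩ := hmem i x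
    by_cases hts : t = s
    · exact hts ▸ ht
    · exact absurd (mem_biUnion (show t ∈ ({s}ᶜ : Set S) from hts) ht) hx
  refine ⟨fun i s => (⋃ t ∈ ({s}ᶜ : Set S), F i t)ᶜ, fun i s => ((hP i).1 _).isOpen_compl,
    fun i s => (hVF i s).trans ((hP i).2.1 s), fun x => ?_, fun i s t hst => ?_⟩
  · let m : ℕ → S := fun n => hwf.wf.min {s | x ∈ F n s} (hmem n x)
    have hm : ∀ n, x ∈ F n (m n) := fun n => hwf.wf.min_mem {s | x ∈ F n s} (hmem n x)
    have hle : ∀ n s, x ∈ F (n + 1) s → s ≤ m n := fun n s hs =>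
      not_lt.1 fun hlt => Set.disjoint_left.1 (hd n s (m n) hlt) hs (hm n)
    have hmin : ∀ n s, x ∈ F n s → m n ≤ s := fun n s hs =>
      not_lt.1 (hwf.wf.not_lt_min {s | x ∈ F n s} hs)
    have hne : (range m).Nonempty := ⟨m 0, mem_range_self 0⟩
    obtain ⟨i, hi⟩ := hwf.wf.min_mem (range m) hne
    have hstat : m (i + 1) = m i := by
      refine le_antisymm (hle i _ (hm _)) ?_
      rw [hi]
      exact not_lt.1 (hwf.wf.not_lt_min (range m) (mem_range_self _))
    refine ⟨i + 1, m i, ?_⟩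
    simp only [mem_compl_iff, mem_iUnion, not_exists]
    intro t ht hxt
    exact ht (le_antisymm (hle i t hxt) (hstat ▸ hmin (i + 1) t hxt))
  · rw [Set.disjoint_left]
    intro x hx hxt
    exact hxt (mem_biUnion (show s ∈ ({t}ᶜ : Set S) from hst) (hVF i s hx))

/-- Michael's criterion: closure-preserving closed refinements of all open covers make a space
paracompact. -/
theorem paracompactSpace (h : HasClosurePreservingRefinements X) : ParacompactSpace X := by
  have := h.normalSpace
  refine ⟨fun S U hU hcov => ?_⟩
  obtain ⟨V, hVo, hVU, hVc, hVd⟩ := h.exists_sigma_disjoint U hU hcov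
  obtain ⟨E, hE, hEV, hEc⟩ := h (ℕ × S) (fun p => V p.1 p.2) (fun p => hVo _ _)
    (eq_univ_of_forall fun x => by
      obtain ⟨i, s, hx⟩ := hVc x
      exact mem_iUnion.2 ⟨(i, s), hx⟩)
  -- Shrinking the unions `⋃ s, V i s` turns the disjoint families into discrete ones.
  have hsep : ∀ i, ∃ G : Set X, IsOpen G ∧ (⋃ s, E (i, s)) ⊆ G ∧ closure G ⊆ ⋃ s, V i s := by
    intro i
    refine normal_exists_closure_subset ?_ (isOpen_iUnion (hVo i))
      (iUnion_mono fun s => hEV (i, s))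
    have := hE {p | p.1 = i}
    convert this using 1
    ext x
    simp
  choose G hGo hEG hGV using hsep
  have hsep' : ∀ i, ∃ P : Set X, IsOpen P ∧ (⋃ s, E (i, s)) ⊆ P ∧ closure P ⊆ G i := by
    intro i
    refine normal_exists_closure_subset ?_ (hGo i) (hEG i)
    have := hE {p | p.1 = i}
    convert this using 1
    ext x
    simp
  choose P hPo hEP hPG using hsep'
  have hPc : ∀ x, ∃ i, x ∈ P i := fun x => by
    have hx : x ∈ ⋃ p, E p := hEc ▸ mem_univ x
    obtain ⟨⟨i, s⟩, hp⟩ := mem_iUnion.1 hx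
    exact ⟨i, hEP i (mem_iUnion.2 ⟨s, hp⟩)⟩
  let C : ℕ → Set X := fun i => ⋃ j ∈ Finset.range i, closure (P j)
  have hC : ∀ i, IsClosed (C i) := fun i =>
    (Finset.range i).finite_toSet.isClosed_biUnion fun j _ => isClosed_closure
  refine ⟨ℕ × S, fun p => (V p.1 p.2 ∩ G p.1) \ C p.1,
    fun p => ((hVo _ _).inter (hGo _)).sdiff (hC _), eq_univ_of_forall fun x => ?_, fun x => ?_,
    fun p => ⟨p.2, fun x hx => hVU _ _ hx.1.1⟩⟩
  · have hex : ∃ i, x ∈ G i := by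
      obtain ⟨i, hi⟩ := hPc x
      exact ⟨i, hPG i (subset_closure hi)⟩
    classical
    obtain ⟨s, hs⟩ := mem_iUnion.1 (hGV _ (subset_closure (Nat.find_spec hex)))
    refine mem_iUnion.2 ⟨(Nat.find hex, s), ⟨hs, Nat.find_spec hex⟩, ?_⟩
    simp only [C, mem_iUnion, not_exists, Finset.mem_range]
    exact fun j hj hx => Nat.find_min hex hj (hPG j hx)
  · obtain ⟨j, hj⟩ := hPc x
    have hloc : ∀ i, LocallyFinite fun s => V i s ∩ G i := by
      intro i z
      by_cases hz : z ∈ closure (G i)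
      · obtain ⟨s, hs⟩ := mem_iUnion.1 (hGV i hz)
        refine ⟨V i s, (hVo i s).mem_nhds hs, (finite_singleton s).subset ?_⟩
        rintro t ⟨y, hy, hys⟩
        by_contra hts
        exact Set.disjoint_left.1 (hVd i t s hts) hy.1 hys
      · refine ⟨(closure (G i))ᶜ, isClosed_closure.isOpen_compl.mem_nhds hz,
          finite_empty.subset ?_⟩
        rintro t ⟨y, hy, hys⟩
        exact hys (subset_closure hy.2)
    choose N hN hNf using fun i => hloc i x
    refine ⟨P j ∩ ⋂ i ∈ Finset.range (j + 1), N i,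
      Filter.inter_mem ((hPo j).mem_nhds hj)
        ((Filter.biInter_finset_mem _).2 fun i _ => hN i), ?_⟩
    have hfin : (⋃ i ∈ (Finset.range (j + 1) : Set ℕ),
        Prod.mk i '' {s | ((V i s ∩ G i) ∩ N i).Nonempty}).Finite :=
      (Finset.finite_toSet _).biUnion fun i _ => (hNf i).image _
    refine hfin.subset ?_
    rintro ⟨i, s⟩ ⟨y, hy, hyP, hyN⟩
    have hij : i < j + 1 := by
      by_contra hlt
      refine hy.2 (mem_biUnion (x := j) ?_ (subset_closure hyP))
      simp only [Finset.coe_range, mem_Iio]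
      omega
    refine mem_biUnion (x := i) (by simpa using hij) ⟨s, ⟨y, hy.1, ?_⟩, rfl⟩
    simp only [mem_iInter, Finset.mem_range] at hyN
    exact hyN i hij

end HasClosurePreservingRefinements

/-- If every lower semi-continuous mapping into a discrete space has an upper semi-continuous
selection, then a cover `U` is refined by the fibres of a selection of `x ↦ {s | x ∈ U s}`. -/
theorem hasClosurePreservingRefinements_of_usc_selection {X : Type u} [TopologicalSpace X]
    (h : ∀ (Y : Type u) [TopologicalSpace Y] [DiscreteTopology Y] (θ : SetValuedMap X Y), θ.IsLSC →
      ∃ ψ : SetValuedMap X Y, ψ.IsSelection θ ∧ ψ.IsUSC) :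
    HasClosurePreservingRefinements X := by
  intro S U hU hcov
  let _ : TopologicalSpace S := ⊥
  have : DiscreteTopology S := ⟨rfl⟩
  have hmem : ∀ x, ∃ s, x ∈ U s := fun x => by
    have hx : x ∈ ⋃ s, U s := hcov ▸ mem_univ x
    exact mem_iUnion.1 hx
  obtain ⟨ψ, hψ, hu⟩ := h S ⟨fun x => {s | x ∈ U s}, hmem⟩ ((SetValuedMap.isLSC_iff _).2 (by
    intro H _
    have : SetValuedMap.preimage ⟨fun x => {s | x ∈ U s}, hmem⟩ H = ⋃ s ∈ H, U s := by
      ext x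
      simp [SetValuedMap.preimage, Set.Nonempty, and_comm]
    rw [this]
    exact isOpen_biUnion fun s _ => hU s))
  rw [SetValuedMap.isUSC_iff] at hu
  refine ⟨fun s => ψ.preimage {s}, fun T => ?_, fun s x hx => ?_, eq_univ_of_forall fun x => ?_⟩
  · have : ⋃ s ∈ T, ψ.preimage {s} = ψ.preimage T := by
      ext x
      simp [SetValuedMap.preimage, Set.Nonempty, and_comm]
    rw [this]
    exact hu T (isClosed_discrete T)
  · obtain ⟨t, ht, rfl⟩ := hx
    exact hψ x ht
  · obtain ⟨s, hs⟩ := ψ.nonempty' x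
    exact mem_iUnion.2 ⟨s, s, hs, rfl⟩

/-- A `T₁`-space whose lower semi-continuous mappings into discrete spaces have upper
semi-continuous selections is paracompact and Hausdorff. -/
theorem t2Space_and_paracompactSpace_of_usc_selection {X : Type u} [TopologicalSpace X] [T1Space X]
    (h : ∀ (Y : Type u) [TopologicalSpace Y] [DiscreteTopology Y] (θ : SetValuedMap X Y), θ.IsLSC →
      ∃ ψ : SetValuedMap X Y, ψ.IsSelection θ ∧ ψ.IsUSC) :
    T2Space X ∧ ParacompactSpace X := by
  have hX := hasClosurePreservingRefinements_of_usc_selection h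
  have := hX.normalSpace
  exact ⟨inferInstance, hX.paracompactSpace⟩

/-! ### Zero-dimensional open sets and clopen partitions -/

section ZeroDimensional

variable {X : Type u} [TopologicalSpace X]

theorem isOpen_zeroDimPart : IsOpen (zeroDimPart X) := isOpen_sUnion fun _ hU => hU.1

theorem isClosed_cozeroKernel : IsClosed (cozeroKernel X) := isOpen_zeroDimPart.isClosed_compl

theorem coveringDim_eq_zero_iff :
    coveringDim X = 0 ↔ CoveringDimLE X 0 ∧ Nonempty X := by
  have hbot : CoveringDimLE X ⊥ ↔ IsEmpty X := by
    constructor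
    · intro h
      refine ⟨fun x => ?_⟩
      obtain ⟨𝒱, -, -, -, h𝒱⟩ := h {univ} (finite_singleton _) ⟨by simp, by simp⟩
      have := h𝒱 x
      simp at this
    · intro _ 𝒰 hf h𝒰
      exact ⟨𝒰, hf, h𝒰, fun U hU => ⟨U, hU, Subset.rfl⟩, fun x => isEmptyElim x⟩
  constructor
  · intro h
    have hne : {d | CoveringDimLE X d}.Nonempty := by
      rw [nonempty_iff_ne_empty]
      intro he
      rw [coveringDim, he, sInf_empty] at h
      exact absurd h (by decide)
    have hmem := csInf_mem hne
    refine ⟨?_, ?_⟩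
    · have : CoveringDimLE X (coveringDim X) := hmem
      rwa [h] at this
    · by_contra hX
      rw [not_nonempty_iff] at hX
      have : coveringDim X ≤ ⊥ := sInf_le (hbot.2 hX)
      rw [h] at this
      simp at this
  · rintro ⟨h, hX⟩
    refine le_antisymm (sInf_le h) (le_sInf fun d hd => ?_)
    induction d with
    | bot => exact absurd (hbot.1 hd) (not_isEmpty_iff.2 hX)
    | coe d => exact_mod_cast zero_le

/-- Inside an open set of dimension zero, a closed set has a clopen neighbourhood within any open
set whose closure stays in the zero-dimensional set. -/
theorem exists_isClopen_between_of_coveringDim_eq_zero {U M N : Set X} (hU : IsOpen U)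
    (hd : coveringDim U = 0) (hM : IsClosed M) (hN : IsOpen N) (hMN : M ⊆ N)
    (hNU : closure N ⊆ U) : ∃ C, IsClopen C ∧ M ⊆ C ∧ C ⊆ N := by
  obtain ⟨𝒱, -, ⟨h𝒱o, h𝒱c⟩, href, hone⟩ := (coveringDim_eq_zero_iff.1 hd).1
    {Subtype.val ⁻¹' N, Subtype.val ⁻¹' Mᶜ} (by simp)
    ⟨by
      rintro V (rfl | rfl)
      · exact hN.preimage continuous_subtype_val
      · exact hM.isOpen_compl.preimage continuous_subtype_val,
     by
      refine eq_univ_of_forall fun x => ?_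
      by_cases hx : (x : X) ∈ M
      · exact ⟨_, Or.inl rfl, hMN hx⟩
      · exact ⟨_, Or.inr rfl, hx⟩⟩
  have huniq : ∀ x : U, ∀ V ∈ 𝒱, ∀ W ∈ 𝒱, x ∈ V → x ∈ W → V = W := by
    intro x V hV W hW hxV hxW
    have h1 : {V ∈ 𝒱 | x ∈ V}.encard ≤ 1 := by
      have := hone x
      rw [zero_add] at this
      exact_mod_cast this
    exact encard_le_one_iff.1 h1 V W ⟨hV, hxV⟩ ⟨hW, hxW⟩
  have hNU' : N ⊆ U := subset_closure.trans hNU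
  let C : Set X := Subtype.val '' ⋃₀ {V ∈ 𝒱 | V ⊆ Subtype.val ⁻¹' N}
  let C' : Set X := Subtype.val '' ⋃₀ {V ∈ 𝒱 | ¬ V ⊆ Subtype.val ⁻¹' N}
  have hCN : C ⊆ N := by
    rintro _ ⟨x, ⟨V, ⟨-, hVN⟩, hxV⟩, rfl⟩
    exact hVN hxV
  have hCo : IsOpen C := hU.isOpenMap_subtype_val _ (isOpen_sUnion fun V hV => h𝒱o V hV.1)
  have hCo' : IsOpen C' := hU.isOpenMap_subtype_val _ (isOpen_sUnion fun V hV => h𝒱o V hV.1)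
  have hCc : Cᶜ = C' ∪ (closure N)ᶜ := by
    ext x
    constructor
    · intro hx
      by_cases hxN : x ∈ closure N
      · have hmem : (⟨x, hNU hxN⟩ : U) ∈ ⋃₀ 𝒱 := h𝒱c ▸ mem_univ _
        obtain ⟨V, hV, hxV⟩ := hmem
        refine Or.inl ⟨_, ⟨V, ⟨hV, fun hVN => hx ⟨_, ⟨V, ⟨hV, hVN⟩, hxV⟩, rfl⟩⟩, hxV⟩, rfl⟩
      · exact Or.inr hxN
    · rintro (⟨x, ⟨V, ⟨hV, hVN⟩, hxV⟩, rfl⟩ | hx) hxC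
      · obtain ⟨y, ⟨W, ⟨hW, hWN⟩, hyW⟩, hyx⟩ := hxC
        obtain rfl := Subtype.ext hyx
        exact hVN (huniq y V hV W hW hxV hyW ▸ hWN)
      · exact hx (subset_closure (hCN hxC))
  refine ⟨C, ⟨⟨?_⟩, hCo⟩, fun x hx => ?_, hCN⟩
  · rw [hCc]
    exact hCo'.union isClosed_closure.isOpen_compl
  · have hmem : (⟨x, hNU' (hMN hx)⟩ : U) ∈ ⋃₀ 𝒱 := h𝒱c ▸ mem_univ _
    obtain ⟨V, hV, hxV⟩ := hmem
    obtain ⟨W, rfl | rfl, hVW⟩ := href V hV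
    · exact ⟨_, ⟨V, ⟨hV, hVW⟩, hxV⟩, rfl⟩
    · exact absurd hx (hVW hxV)

/-- A locally finite clopen family can be made disjoint without changing its union. -/
theorem LocallyFinite.exists_disjoint_isClopen {κ : Type*} {C : κ → Set X} (hf : LocallyFinite C)
    (hC : ∀ k, IsClopen (C k)) : ∃ D : κ → Set X, (∀ k, IsClopen (D k)) ∧ (∀ k, D k ⊆ C k) ∧
      ⋃ k, D k = ⋃ k, C k ∧ Pairwise (Function.onFun Disjoint D) := by
  obtain ⟨_, hwf⟩ := exists_wellFoundedLT κ
  have hlt : ∀ k, IsClopen (⋃ j : Iio k, C j) := fun k =>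
    ⟨(hf.comp_injective Subtype.val_injective).isClosed_iUnion fun j => (hC j.1).1,
      isOpen_iUnion fun j => (hC j.1).2⟩
  have hdis : ∀ j k, j < k → Disjoint (C j \ ⋃ i : Iio j, C i) (C k \ ⋃ i : Iio k, C i) := by
    intro j k hjk
    rw [Set.disjoint_left]
    intro x hx hxk
    exact hxk.2 (mem_iUnion.2 ⟨⟨j, hjk⟩, hx.1⟩)
  refine ⟨fun k => C k \ ⋃ j : Iio k, C j, fun k => (hC k).diff (hlt k),
    fun k => sdiff_subset, ?_, fun j k hjk => ?_⟩
  · refine Subset.antisymm (iUnion_mono fun k => sdiff_subset) fun x hx => ?_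
    have hne : {k | x ∈ C k}.Nonempty := mem_iUnion.1 hx
    refine mem_iUnion.2 ⟨hwf.wf.min _ hne, hwf.wf.min_mem _ hne, ?_⟩
    simp only [mem_iUnion, not_exists]
    rintro ⟨j, hj⟩ hxj
    exact hwf.wf.not_lt_min {k | x ∈ C k} hxj hj
  · rcases lt_or_gt_of_ne hjk with h | h
    · exact hdis j k h
    · exact (hdis k j h).symm

/-- A closed set of points with zero-dimensional neighbourhoods is covered by disjoint clopen sets
that refine a prescribed open cover. -/
theorem exists_disjoint_isClopen_refinement [T2Space X] [ParacompactSpace X] {F : Set X}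
    (hF : IsClosed F) (hFω : F ⊆ zeroDimPart X) {ι : Type u} (O : ι → Set X)
    (hO : ∀ i, IsOpen (O i)) (hFO : F ⊆ ⋃ i, O i) :
    ∃ C : ι → Set X, (∀ i, IsClopen (C i)) ∧ (∀ i, C i ⊆ O i) ∧ F ⊆ ⋃ i, C i ∧
      Pairwise (Function.onFun Disjoint C) := by
  let 𝒵 : Set (Set X) := {U : Set X | IsOpen U ∧ coveringDim U = 0}
  obtain ⟨N', hN'o, hFN', hN'f, hN'⟩ := precise_refinement_set hF
    (fun k : ι × 𝒵 => O k.1 ∩ k.2) (fun k => (hO _).inter k.2.2.1)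
    (fun x hx => by
      obtain ⟨i, hi⟩ := mem_iUnion.1 (hFO hx)
      obtain ⟨U, hU, hxU⟩ := hFω hx
      exact mem_iUnion.2 ⟨(i, ⟨U, hU⟩), hi, hxU⟩)
  obtain ⟨N, hFN, hNo, hN⟩ := exists_subset_iUnion_closure_subset hF hN'o
    (fun x _ => hN'f.point_finite x) hFN'
  have hNf : LocallyFinite N := hN'f.subset fun k => subset_closure.trans (hN k)
  obtain ⟨M, hFM, hMc, hM⟩ := exists_subset_iUnion_closed_subset hF hNo
    (fun x _ => hNf.point_finite x) hFN
  choose C hC hMC hCN using fun k : ι × 𝒵 => exists_isClopen_between_of_coveringDim_eq_zero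
    k.2.2.1 k.2.2.2 (hMc k) (hNo k) (hM k) ((hN k).trans ((hN' k).trans inter_subset_right))
  have hCf : LocallyFinite C := hNf.subset hCN
  obtain ⟨D, hD, hDC, hDU, hDd⟩ := hCf.exists_disjoint_isClopen hC
  have hDf : LocallyFinite D := hCf.subset hDC
  refine ⟨fun i => ⋃ U : 𝒵, D (i, U), fun i => ⟨?_, isOpen_iUnion fun U => (hD _).2⟩,
    fun i => iUnion_subset fun U => ?_, fun x hx => ?_, fun i j hij => ?_⟩
  · exact (hDf.comp_injective (Prod.mk_right_injective i)).isClosed_iUnion fun U => (hD _).1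
  · exact (hDC _).trans ((hCN _).trans (subset_closure.trans
      ((hN _).trans ((hN' _).trans inter_subset_left))))
  · have hxD : x ∈ ⋃ k, D k := by
      rw [hDU]
      obtain ⟨k, hk⟩ := mem_iUnion.1 (hFM hx)
      exact mem_iUnion.2 ⟨k, hMC k hk⟩
    obtain ⟨⟨i, U⟩, hk⟩ := mem_iUnion.1 hxD
    exact mem_iUnion.2 ⟨i, mem_iUnion.2 ⟨U, hk⟩⟩
  · simp only [Function.onFun, disjoint_iUnion_left, disjoint_iUnion_right]
    exact fun U V => hDd fun h => hij (congrArg Prod.fst h)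

/-- The cozero-dimensional kernel of a paracompact space has a base of clopen neighbourhoods. -/
theorem exists_isClopen_cozeroKernel_subset [T2Space X] [ParacompactSpace X] {O : Set X}
    (hO : IsOpen O) (hKO : cozeroKernel X ⊆ O) :
    ∃ G, IsClopen G ∧ cozeroKernel X ⊆ G ∧ G ⊆ O := by
  have hsub : Oᶜ ⊆ zeroDimPart X := compl_subset_comm.1 hKO
  obtain ⟨C, hC, hCω, hOC, -⟩ := exists_disjoint_isClopen_refinement hO.isClosed_compl hsub
    (fun _ : PUnit => zeroDimPart X) (fun _ => isOpen_zeroDimPart)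
    (fun x hx => mem_iUnion.2 ⟨⟨⟩, hsub hx⟩)
  refine ⟨(C ⟨⟩)ᶜ, (hC _).compl, compl_subset_compl.2 (hCω _), compl_subset_comm.1 fun x hx => ?_⟩
  obtain ⟨_, h⟩ := mem_iUnion.1 (hOC hx)
  exact h

/-- Every indexed open cover has a precise refinement by pairwise disjoint open sets. -/
def HasDisjointRefinements (Z : Type u) [TopologicalSpace Z] : Prop :=
  ∀ (ι : Type u) (O : ι → Set Z), (∀ i, IsOpen (O i)) → ⋃ i, O i = univ →
    ∃ W : ι → Set Z, (∀ i, IsOpen (W i)) ∧ (∀ i, W i ⊆ O i) ∧ ⋃ i, W i = univ ∧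
      Pairwise (Function.onFun Disjoint W)

/-- Off the intersection of a sequence of clopen neighbourhoods of the cozero-dimensional kernel
the space is a disjoint sum of clopen pieces that lie in the zero-dimensional part. -/
theorem hasDisjointRefinements_compl_iInter [T2Space X] [ParacompactSpace X] {G : ℕ → Set X}
    (hG : ∀ n, IsClopen (G n)) (hKG : ∀ n, cozeroKernel X ⊆ G n) :
    HasDisjointRefinements ((⋂ n, G n)ᶜ : Set X) := by
  intro ι O hO hOc
  have hopen : IsOpen ((⋂ n, G n)ᶜ : Set X) :=
    (isClosed_iInter fun n => (hG n).1).isOpen_compl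
  let D : ℕ → Set X := fun n => (G n)ᶜ ∩ ⋂ m ∈ Finset.range n, G m
  have hD : ∀ n, IsClopen (D n) := fun n =>
    (hG n).compl.inter (isClopen_biInter_finset fun m _ => hG m)
  have hDd : ∀ m n, m < n → Disjoint (D m) (D n) := by
    intro m n hmn
    rw [Set.disjoint_left]
    intro x hxm hxn
    have := hxn.2
    simp only [mem_iInter, Finset.mem_range] at this
    exact hxm.1 (this m hmn)
  have hDne : ∀ m n, m ≠ n → Disjoint (D m) (D n) := fun m n hmn =>
    (lt_or_gt_of_ne hmn).elim (hDd m n) fun h => (hDd n m h).symm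
  have hDsub : ∀ n, D n ⊆ (⋂ n, G n)ᶜ := fun n x hx hxG => hx.1 (mem_iInter.1 hxG n)
  choose C hC hCO hDC hCd using fun n => exists_disjoint_isClopen_refinement (hD n).1
    (fun x hx => not_not.1 fun h => hx.1 (hKG n h)) (fun i => Subtype.val '' O i)
    (fun i => hopen.isOpenMap_subtype_val _ (hO i))
    (fun x hx => by
      have hmem : (⟨x, hDsub n hx⟩ : ((⋂ n, G n)ᶜ : Set X)) ∈ ⋃ i, O i := hOc ▸ mem_univ _
      obtain ⟨i, hi⟩ := mem_iUnion.1 hmem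
      exact mem_iUnion.2 ⟨i, _, hi, rfl⟩)
  refine ⟨fun i => Subtype.val ⁻¹' ⋃ n, C n i ∩ D n,
    fun i => (isOpen_iUnion fun n => (hC n i).2.inter (hD n).2).preimage continuous_subtype_val,
    fun i x hx => ?_, eq_univ_of_forall fun x => ?_, fun i j hij => ?_⟩
  · obtain ⟨n, hn, -⟩ := mem_iUnion.1 hx
    obtain ⟨y, hy, hyx⟩ := hCO n i hn
    exact Subtype.ext hyx ▸ hy
  · classical
    have hx : ∃ n, (x : X) ∉ G n := by
      have := x.2
      simpa using this
    have hxD : (x : X) ∈ D (Nat.find hx) := by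
      refine ⟨Nat.find_spec hx, ?_⟩
      simp only [mem_iInter, Finset.mem_range]
      exact fun m hm => not_not.1 (Nat.find_min hx hm)
    obtain ⟨i, hi⟩ := mem_iUnion.1 (hDC _ hxD)
    exact mem_iUnion.2 ⟨i, mem_iUnion.2 ⟨_, hi, hxD⟩⟩
  · refine Disjoint.preimage _ ?_
    simp only [disjoint_iUnion_left, disjoint_iUnion_right]
    intro n m
    by_cases hmn : m = n
    · subst hmn
      exact (hCd m hij).mono inter_subset_left inter_subset_left
    · exact (hDne _ _ hmn).mono inter_subset_right inter_subset_right

/-- If any two disjoint closed sets near `d` are separated by a clopen set, then `d` has an open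
neighbourhood of dimension zero. -/
theorem mem_zeroDimPart_of_clopen_separation [NormalSpace X] [T1Space X] {V : Set X} {d : X}
    (hV : IsOpen V) (hd : d ∈ V)
    (hsep : ∀ A B : Set X, IsClosed A → IsClosed B → A ⊆ V → B ⊆ V → Disjoint A B →
      ∃ C, IsClopen C ∧ A ⊆ C ∧ Disjoint B C) : d ∈ zeroDimPart X := by
  obtain ⟨O, hO, hdO, hOV⟩ := normal_exists_closure_subset (isClosed_singleton (x := d)) hV
    (singleton_subset_iff.2 hd)
  obtain ⟨C, hC, hdC, hBC⟩ := hsep {d} (closure O \ O) isClosed_singleton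
    (isClosed_closure.sdiff hO) (singleton_subset_iff.2 hd) (sdiff_subset.trans hOV)
    (disjoint_sdiff_right.mono_left hdO)
  have hU : C ∩ O = C ∩ closure O := by
    refine Subset.antisymm (inter_subset_inter_right _ subset_closure) fun x hx => ⟨hx.1, ?_⟩
    by_contra hxO
    exact Set.disjoint_left.1 hBC ⟨hx.2, hxO⟩ hx.1
  have hUo : IsOpen (C ∩ O) := hC.2.inter hO
  have hUc : IsClosed (C ∩ O) := hU ▸ hC.1.inter isClosed_closure
  have hUV : C ∩ O ⊆ V := inter_subset_right.trans (subset_closure.trans hOV)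
  refine ⟨C ∩ O, ⟨hUo, coveringDim_eq_zero_iff.2 ⟨?_, ⟨d, hdC rfl, hdO rfl⟩⟩⟩, hdC rfl, hdO rfl⟩
  intro 𝒰 hfin ⟨h𝒰o, h𝒰c⟩
  have hnormal : NormalSpace ↥(C ∩ O) := hUc.isClosedEmbedding_subtypeVal.normalSpace
  have := hfin.to_subtype
  obtain ⟨F, hFc, hF, hFU⟩ := exists_iUnion_eq_closed_subset (u := fun U : 𝒰 => (U : Set ↥(C ∩ O)))
    (fun U => h𝒰o _ U.2) (fun x => Set.toFinite _) (by rw [← sUnion_eq_iUnion, h𝒰c])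
  choose E hE hFE hEd using fun U : 𝒰 => hsep (Subtype.val '' F U)
    (Subtype.val '' (U : Set ↥(C ∩ O))ᶜ)
    (hUc.isClosedEmbedding_subtypeVal.isClosedMap _ (hF U))
    (hUc.isClosedEmbedding_subtypeVal.isClosedMap _ (h𝒰o _ U.2).isClosed_compl)
    ((Subtype.coe_image_subset _ _).trans hUV) ((Subtype.coe_image_subset _ _).trans hUV)
    ((disjoint_image_iff Subtype.val_injective).2 (disjoint_compl_right.mono_left (hFU U)))
  obtain ⟨D, hD, hDE, hDU, hDd⟩ := (locallyFinite_of_finite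
    fun U : 𝒰 => (Subtype.val ⁻¹' E U : Set ↥(C ∩ O))).exists_disjoint_isClopen
    fun U => (hE U).preimage continuous_subtype_val
  refine ⟨range D, finite_range D, ⟨by rintro _ ⟨U, rfl⟩; exact (hD U).2, ?_⟩, ?_, fun x => ?_⟩
  · rw [sUnion_range, hDU]
    refine eq_univ_of_forall fun x => ?_
    have hx : x ∈ ⋃ U, F U := hFc ▸ mem_univ x
    obtain ⟨U, hxU⟩ := mem_iUnion.1 hx
    exact mem_iUnion.2 ⟨U, hFE U ⟨x, hxU, rfl⟩⟩
  · rintro _ ⟨U, rfl⟩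
    refine ⟨U, U.2, fun x hx => ?_⟩
    by_contra hxU
    exact Set.disjoint_left.1 (hEd U) ⟨x, hxU, rfl⟩ (hDE U hx)
  · rw [zero_add]
    have : {V ∈ range D | x ∈ V}.encard ≤ 1 := by
      rw [encard_le_one_iff]
      rintro _ _ ⟨⟨U, rfl⟩, hxU⟩ ⟨⟨W, rfl⟩, hxW⟩
      by_contra hne
      exact Set.disjoint_left.1 (hDd fun h : U = W => hne (h ▸ rfl)) hxU hxW
    exact_mod_cast this

end ZeroDimensional

/-! ### Sieves and Michael's selection theorems -/

section Sieves

open Filter Topology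

theorem exists_const_mul_half_pow_lt (c : ℝ) {ε : ℝ} (hε : 0 < ε) :
    ∃ n : ℕ, c * (1 / 2 : ℝ) ^ n < ε := by
  have h := (tendsto_pow_atTop_nhds_zero_of_lt_one (r := (1 / 2 : ℝ)) (by norm_num)
    (by norm_num)).const_mul c
  rw [mul_zero] at h
  exact ((tendsto_order.1 h).2 ε hε).exists

/-- The set of limits of branches of the tree `W` through `x`, described by approximation: at every
depth `n` some node through `x` lists a point at distance at most `2 · 2⁻ⁿ`. -/
def branchLimits {X Y : Type u} [MetricSpace Y] (W : List Y → Set X) (x : X) : Set Y :=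
  ⋂ n : ℕ, {p | ∃ y s, s.length = n ∧ x ∈ W (y :: s) ∧ dist p y ≤ 2 * (1 / 2) ^ n}

theorem branchLimits_mono {X Y : Type u} [MetricSpace Y] {W W' : List Y → Set X}
    (h : ∀ s, W s ⊆ W' s) (x : X) :
    branchLimits W x ⊆ branchLimits W' x :=
  iInter_mono fun _ _ ⟨y, s, hs, hx, hp⟩ => ⟨y, s, hs, h _ hx, hp⟩

variable {X Y : Type u} [TopologicalSpace X] [MetricSpace Y]

/-- A sieve for `θ` is a tree of subsets of `X` whose nodes are finite lists of points of `Y`, most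
recent point first.  The children `W (y :: s)` form a locally finite cover of `W s`; a child lists
a point close to that of its parent, and every point listed at depth `n` is within `2⁻ⁿ` of `θ x`
for each `x` in its node. -/
structure IsSieve (θ : SetValuedMap X Y) (W : List Y → Set X) : Prop where
  nil : W [] = univ
  iUnion_cons : ∀ s, ⋃ y, W (y :: s) = W s
  locallyFinite : ∀ s, LocallyFinite fun y => W (y :: s)
  dist_le : ∀ s y z, (W (y :: z :: s)).Nonempty → dist y z ≤ (1 / 2) ^ s.length
  exists_near : ∀ s y, ∀ x ∈ W (y :: s), ∃ z ∈ θ x, dist z y < (1 / 2) ^ s.length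

namespace IsSieve

variable {θ : SetValuedMap X Y} {W : List Y → Set X}

theorem cons_subset (h : IsSieve θ W) (y : Y) (s : List Y) : W (y :: s) ⊆ W s :=
  h.iUnion_cons s ▸ subset_iUnion (fun y => W (y :: s)) y

theorem exists_cons (h : IsSieve θ W) {s : List Y} {x : X} (hx : x ∈ W s) :
    ∃ y, x ∈ W (y :: s) := by
  rw [← h.iUnion_cons] at hx
  exact mem_iUnion.1 hx

theorem finite_nodes (h : IsSieve θ W) (x : X) (n : ℕ) : {s | s.length = n ∧ x ∈ W s}.Finite := by
  induction n with
  | zero => exact (finite_singleton []).subset fun s hs => List.length_eq_zero_iff.1 hs.1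
  | succ n ih =>
    refine (ih.biUnion fun s _ =>
      ((h.locallyFinite s).point_finite x).image fun y => y :: s).subset ?_
    rintro (_ | ⟨y, s⟩) ⟨hs, hx⟩
    · simp at hs
    · exact mem_biUnion (x := s) ⟨by simpa using hs, h.cons_subset y s hx⟩ ⟨y, hx, rfl⟩

theorem exists_ancestor (h : IsSieve θ W) {x : X} {p : Y} (s : List Y) :
    ∀ y, x ∈ W (y :: s) → dist p y ≤ 2 * (1 / 2) ^ s.length → ∀ n ≤ s.length,
      ∃ y' s', s'.length = n ∧ x ∈ W (y' :: s') ∧ dist p y' ≤ 2 * (1 / 2) ^ n := by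
  induction s with
  | nil =>
    intro y hx hp n hn
    obtain rfl : n = 0 := by simpa using hn
    exact ⟨y, [], rfl, hx, hp⟩
  | cons z s ih =>
    intro y hx hp n hn
    rcases hn.eq_or_lt with rfl | hlt
    · exact ⟨y, z :: s, rfl, hx, hp⟩
    · refine ih z (h.cons_subset _ _ hx) ?_ n (by simpa [Nat.lt_succ_iff] using hlt)
      have h1 := h.dist_le s y z ⟨x, hx⟩
      have h2 := dist_triangle p y z
      rw [List.length_cons, pow_succ] at hp
      linarith

/-- Every node extends to an infinite branch, whose limit is close to the point of the node. -/
theorem exists_mem_branchLimits [CompleteSpace Y] (h : IsSieve θ W) {x : X} {y : Y} {s : List Y}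
    (hx : x ∈ W (y :: s)) : ∃ p ∈ branchLimits W x, dist p y ≤ 2 * (1 / 2) ^ s.length := by
  have hnext : ∀ t : List Y, x ∈ W t → ∃ z, x ∈ W (z :: t) := fun t => h.exists_cons
  have : Nonempty Y := ⟨y⟩
  choose! nx hnx using hnext
  let L : ℕ → Y × List Y := fun k =>
    (fun q : Y × List Y => (nx (q.1 :: q.2), q.1 :: q.2))^[k] (y, s)
  have hL : ∀ k, L (k + 1) = (nx ((L k).1 :: (L k).2), (L k).1 :: (L k).2) := fun k =>
    Function.iterate_succ_apply' _ k (y, s)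
  have hmem : ∀ k, x ∈ W ((L k).1 :: (L k).2) := by
    intro k
    induction k with
    | zero => exact hx
    | succ k ih => rw [hL]; exact hnx _ ih
  have hlen : ∀ k, (L k).2.length = s.length + k := by
    intro k
    induction k with
    | zero => rfl
    | succ k ih => rw [hL, List.length_cons, ih]; rfl
  have hdist : ∀ k, dist (L k).1 (L (k + 1)).1 ≤ 2 * (1 / 2) ^ s.length / 2 / 2 ^ k := by
    intro k
    have h1 := hmem (k + 1)
    rw [hL] at h1
    have h2 := h.dist_le _ _ _ ⟨x, h1⟩
    rw [hlen, pow_add] at h2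
    rw [dist_comm, hL]
    refine h2.trans (le_of_eq ?_)
    rw [one_div, inv_pow 2 k]
    ring
  obtain ⟨p, hp⟩ := cauchySeq_tendsto_of_complete (cauchySeq_of_le_geometric_two hdist)
  have hpd : ∀ k, dist p (L k).1 ≤ 2 * (1 / 2) ^ (s.length + k) := by
    intro k
    rw [dist_comm]
    refine (dist_le_of_le_geometric_two_of_tendsto hdist hp k).trans (le_of_eq ?_)
    rw [pow_add, one_div, inv_pow 2 k]
    ring
  refine ⟨p, mem_iInter.2 fun n => ?_, hpd 0⟩
  rcases le_or_gt n s.length with hn | hn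
  · exact h.exists_ancestor s y hx (hpd 0) n hn
  · refine ⟨(L (n - s.length)).1, (L (n - s.length)).2, ?_, hmem _, ?_⟩
    · rw [hlen]; omega
    · have := hpd (n - s.length)
      rwa [Nat.add_sub_cancel' hn.le] at this

theorem branchLimits_nonempty [CompleteSpace Y] (h : IsSieve θ W) (x : X) :
    (branchLimits W x).Nonempty := by
  obtain ⟨y, hy⟩ := h.exists_cons (h.nil ▸ mem_univ x : x ∈ W [])
  obtain ⟨p, hp, -⟩ := h.exists_mem_branchLimits hy
  exact ⟨p, hp⟩

theorem branchLimits_subset (h : IsSieve θ W) {x : X} (hθ : IsClosed (θ x)) :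
    branchLimits W x ⊆ θ x := by
  intro p hp
  rw [← hθ.closure_eq, Metric.mem_closure_iff]
  intro ε hε
  obtain ⟨n, hn⟩ := exists_const_mul_half_pow_lt 3 hε
  obtain ⟨y, s, hs, hx, hpy⟩ := mem_iInter.1 hp n
  obtain ⟨z, hz, hzy⟩ := h.exists_near s y x hx
  rw [hs] at hzy
  refine ⟨z, hz, ?_⟩
  have := dist_triangle_right p z y
  linarith

theorem isCompact_branchLimits [CompleteSpace Y] (h : IsSieve θ W) (x : X) :
    IsCompact (branchLimits W x) := by
  have hfin : ∀ n, {q : Y × List Y | q.2.length = n ∧ x ∈ W (q.1 :: q.2)}.Finite := by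
    intro n
    refine ((h.finite_nodes x (n + 1)).preimage
      (f := fun q : Y × List Y => q.1 :: q.2) ?_).subset fun q hq => ⟨by simp [hq.1], hq.2⟩
    rintro ⟨a, s⟩ - ⟨b, t⟩ - hab
    simpa using hab
  have heq : ∀ n, {p | ∃ y s, s.length = n ∧ x ∈ W (y :: s) ∧ dist p y ≤ 2 * (1 / 2) ^ n} =
      ⋃ q ∈ {q : Y × List Y | q.2.length = n ∧ x ∈ W (q.1 :: q.2)},
        Metric.closedBall q.1 (2 * (1 / 2) ^ n) := by
    intro n
    ext p
    simp only [mem_ofPred_eq, mem_iUnion, Metric.mem_closedBall, exists_prop, Prod.exists]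
    simp only [and_assoc]
  refine TotallyBounded.isCompact_of_isClosed ?_ (isClosed_iInter fun n => ?_)
  · rw [Metric.totallyBounded_iff]
    intro ε hε
    obtain ⟨n, hn⟩ := exists_const_mul_half_pow_lt 2 hε
    refine ⟨Prod.fst '' {q : Y × List Y | q.2.length = n ∧ x ∈ W (q.1 :: q.2)},
      (hfin n).image _, fun p hp => ?_⟩
    obtain ⟨y, s, hs, hx, hpy⟩ := mem_iInter.1 hp n
    exact mem_biUnion (x := y) ⟨(y, s), ⟨hs, hx⟩, rfl⟩ (hpy.trans_lt hn)
  · rw [heq]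
    exact (hfin n).isClosed_biUnion fun q _ => Metric.isClosed_closedBall

theorem branchLimits_subsingleton (h : IsSieve θ W)
    (hd : ∀ s, Pairwise (Function.onFun Disjoint fun y => W (y :: s))) (x : X) :
    (branchLimits W x).Subsingleton := by
  have hnode : ∀ n, {s | s.length = n ∧ x ∈ W s}.Subsingleton := by
    intro n
    induction n with
    | zero =>
      rintro s ⟨hs, -⟩ t ⟨ht, -⟩
      rw [List.length_eq_zero_iff.1 hs, List.length_eq_zero_iff.1 ht]
    | succ n ih =>
      rintro (_ | ⟨y, s⟩) ⟨hs, hxs⟩ (_ | ⟨z, t⟩) ⟨ht, hxt⟩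
      · rfl
      · simp at hs
      · simp at ht
      · obtain rfl := ih ⟨by simpa using hs, h.cons_subset _ _ hxs⟩
          ⟨by simpa using ht, h.cons_subset _ _ hxt⟩
        by_contra hne
        exact Set.disjoint_left.1 (hd s fun hyz : y = z => hne (hyz ▸ rfl)) hxs hxt
  intro p hp q hq
  refine dist_le_zero.1 (le_of_forall_pos_le_add fun ε hε => ?_)
  obtain ⟨n, hn⟩ := exists_const_mul_half_pow_lt 4 hε
  obtain ⟨y, s, hs, hx, hpy⟩ := mem_iInter.1 hp n
  obtain ⟨z, t, ht, hx', hqz⟩ := mem_iInter.1 hq n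
  have hyz := hnode (n + 1) ⟨by simp [hs], hx⟩ ⟨by simp [ht], hx'⟩
  obtain ⟨rfl, rfl⟩ := List.cons.inj hyz
  have := dist_triangle_right p q y
  linarith

/-- The set-valued mapping of branch limits. -/
def limitMap [CompleteSpace Y] (h : IsSieve θ W) : SetValuedMap X Y :=
  ⟨branchLimits W, h.branchLimits_nonempty⟩

theorem isLSC_limitMap [CompleteSpace Y] (h : IsSieve θ W) (hW : ∀ s, IsOpen (W s)) :
    h.limitMap.IsLSC := by
  rw [SetValuedMap.isLSC_iff]
  intro H hH
  rw [isOpen_iff_mem_nhds]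
  rintro x ⟨p, hp, hpH⟩
  obtain ⟨ε, hε, hball⟩ := Metric.isOpen_iff.1 hH p hpH
  obtain ⟨n, hn⟩ := exists_const_mul_half_pow_lt 4 hε
  obtain ⟨y, s, hs, hx, hpy⟩ := mem_iInter.1 hp n
  filter_upwards [(hW _).mem_nhds hx] with x' hx'
  obtain ⟨p', hp', hp'y⟩ := h.exists_mem_branchLimits hx'
  refine ⟨p', hp', hball ?_⟩
  rw [hs] at hp'y
  have := dist_triangle_right p' p y
  rw [Metric.mem_ball]
  linarith

theorem eventually_node (h : IsSieve θ W) (hW : ∀ s, IsClosed (W s)) (x : X) (n : ℕ) :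
    ∀ᶠ x' in 𝓝 x, ∀ s, s.length = n → x' ∈ W s → x ∈ W s := by
  induction n with
  | zero =>
    refine Eventually.of_forall fun x' s hs _ => ?_
    rw [List.length_eq_zero_iff.1 hs, h.nil]
    trivial
  | succ n ih =>
    have h1 : ∀ᶠ x' in 𝓝 x, ∀ s ∈ {s | s.length = n ∧ x ∈ W s}, ∀ y,
        x' ∈ W (y :: s) → x ∈ W (y :: s) := by
      rw [eventually_all_finite (h.finite_nodes x n)]
      intro s _
      filter_upwards [(h.locallyFinite s).iInter_compl_mem_nhds (fun y => hW _) x] with x' hx' y hy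
      by_contra hxy
      exact (mem_iInter₂.1 hx' y hxy) hy
    filter_upwards [ih, h1] with x' ha hb
    rintro (_ | ⟨y, s⟩) hs hx'
    · simp at hs
    · have hs' : s.length = n := by simpa using hs
      exact hb s ⟨hs', ha s hs' (h.cons_subset _ _ hx')⟩ y hx'

theorem isUSC_limitMap [CompleteSpace Y] (h : IsSieve θ W) (hW : ∀ s, IsClosed (W s)) :
    h.limitMap.IsUSC := by
  unfold SetValuedMap.IsUSC
  rw [upperHemicontinuous_iff_forall_isOpen]
  intro x U hU hxU
  obtain ⟨ε, hε, hthick⟩ := (h.isCompact_branchLimits x).exists_thickening_subset_open hU hxU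
  obtain ⟨n, hn⟩ := exists_const_mul_half_pow_lt 4 hε
  filter_upwards [h.eventually_node hW x (n + 1)] with x' hx' p' hp'
  obtain ⟨y, s, hs, hxs, hpy⟩ := mem_iInter.1 hp' n
  obtain ⟨p, hp, hpy'⟩ := h.exists_mem_branchLimits (hx' (y :: s) (by simp [hs]) hxs)
  refine hthick (Metric.mem_thickening_iff.2 ⟨p, hp, ?_⟩)
  rw [hs] at hpy'
  have := dist_triangle_right p' p y
  linarith

theorem closure (h : IsSieve θ W)
    (hnear : ∀ s y, ∀ x ∈ closure (W (y :: s)), ∃ z ∈ θ x, dist z y < (1 / 2) ^ s.length) :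
    IsSieve θ fun s => closure (W s) where
  nil := by rw [h.nil, closure_univ]
  iUnion_cons s := by rw [← (h.locallyFinite s).closure_iUnion, h.iUnion_cons]
  locallyFinite s := (h.locallyFinite s).closure
  dist_le s y z hne := h.dist_le s y z (closure_nonempty_iff.1 hne)
  exists_near := hnear

end IsSieve

/-- A sieve of open sets is built from any method of covering closed sets by shrunken locally
finite families.  `Q` is an additional property of those families that is inherited by smaller
families and hence by the families of children in the sieve. -/
theorem exists_isSieve (θ : SetValuedMap X Y) (hθ : θ.IsLSC) (Q : (Y → Set X) → Prop)
    (hQ : ∀ W W' : Y → Set X, (∀ y, W' y ⊆ W y) → Q W → Q W')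
    (hstep : ∀ (C : Set X) (O : Y → Set X), IsClosed C → (∀ y, IsOpen (O y)) → C ⊆ ⋃ y, O y →
      ∃ W : Y → Set X, (∀ y, IsOpen (W y)) ∧ LocallyFinite W ∧ C ⊆ ⋃ y, W y ∧
        (∀ y, closure (W y) ⊆ O y) ∧ Q W) :
    ∃ W : List Y → Set X, IsSieve θ W ∧ (∀ s, IsOpen (W s)) ∧
      (IsSieve θ fun s => closure (W s)) ∧ ∀ s, Q fun y => W (y :: s) := by
  classical
  rw [SetValuedMap.isLSC_iff] at hθ
  choose! R hRo hRf hRc hRO hRQ using hstep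
  -- `O s y` is the open set in which the closure of the node `y :: s` has to lie.
  let O : List Y → Y → Set X := fun s y => match s with
    | [] => θ.preimage (Metric.ball y 1)
    | z :: s => if dist y z ≤ (1 / 2) ^ s.length then
        θ.preimage (Metric.ball y ((1 / 2) ^ (s.length + 1))) else ∅
  have hOo : ∀ s y, IsOpen (O s y) := by
    rintro (_ | ⟨z, s⟩) y
    · exact hθ _ Metric.isOpen_ball
    · simp only [O]
      split_ifs
      · exact hθ _ Metric.isOpen_ball
      · exact isOpen_empty
  have hOnear : ∀ s y, O s y ⊆ θ.preimage (Metric.ball y ((1 / 2) ^ s.length)) := by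
    rintro (_ | ⟨z, s⟩) y
    · simp [O]
    · simp only [O]
      split_ifs
      · exact Subset.rfl
      · exact empty_subset _
  let W : List Y → Set X := fun s =>
    List.rec univ (fun y s Ws => Ws ∩ R (closure Ws) (O s) y) s
  have hWcons : ∀ y s, W (y :: s) = W s ∩ R (closure (W s)) (O s) y := fun y s => rfl
  have hcov : ∀ s, closure (W s) ⊆ ⋃ y, O s y := by
    intro s
    induction s with
    | nil =>
      intro x _
      obtain ⟨y, hy⟩ := θ.nonempty' x
      exact mem_iUnion.2 ⟨y, y, hy, Metric.mem_ball_self one_pos⟩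
    | cons z s ih =>
      intro x hx
      have hxO : x ∈ O s z := hRO _ _ isClosed_closure (hOo s) ih z
        (closure_mono inter_subset_right hx)
      obtain ⟨p, hp, hpz⟩ := hOnear s z hxO
      refine mem_iUnion.2 ⟨p, ?_⟩
      simp only [O]
      rw [if_pos (Metric.mem_ball.1 hpz).le]
      exact ⟨p, hp, Metric.mem_ball_self (by positivity)⟩
  have hclO : ∀ s y, closure (W (y :: s)) ⊆ O s y := fun s y =>
    (closure_mono inter_subset_right).trans (hRO _ _ isClosed_closure (hOo s) (hcov s) y)
  have hnear : ∀ s y, ∀ x ∈ closure (W (y :: s)), ∃ z ∈ θ x, dist z y < (1 / 2) ^ s.length := by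
    intro s y x hx
    obtain ⟨z, hz, hzy⟩ := hOnear s y (hclO s y hx)
    exact ⟨z, hz, hzy⟩
  have hS : IsSieve θ W :=
    { nil := rfl
      iUnion_cons := fun s => by
        simp only [hWcons]
        rw [← inter_iUnion, inter_eq_left]
        exact subset_closure.trans (hRc _ _ isClosed_closure (hOo s) (hcov s))
      locallyFinite := fun s => (hRf _ _ isClosed_closure (hOo s) (hcov s)).subset
        fun y => inter_subset_right
      dist_le := by
        rintro s y z ⟨x, hx⟩
        have hxO := hclO (z :: s) y (subset_closure hx)
        simp only [O] at hxO
        by_contra hne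
        rw [if_neg hne] at hxO
        exact hxO
      exists_near := fun s y x hx => hnear s y x (subset_closure hx) }
  refine ⟨W, hS, fun s => ?_, hS.closure hnear, fun s => hQ _ _ (fun y => inter_subset_right)
    (hRQ _ _ isClosed_closure (hOo s) (hcov s))⟩
  induction s with
  | nil => exact isOpen_univ
  | cons y s ih => exact ih.inter (hRo _ _ isClosed_closure (hOo s) (hcov s) y)

/-- Michael's selection theorem for paracompact spaces: a lower semi-continuous closed-valued
mapping into a complete metric space has a compact-valued upper semi-continuous selection, which in
turn has a compact-valued lower semi-continuous selection. -/
theorem exists_lsc_usc_selection [T2Space X] [ParacompactSpace X] [CompleteSpace Y]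
    (θ : SetValuedMap X Y) (hθ : θ.IsLSC) (hc : θ.ClosedValued) :
    ∃ φ ψ : SetValuedMap X Y, φ.CompactValued ∧ φ.IsLSC ∧ ψ.CompactValued ∧ ψ.IsUSC ∧
      ∀ x, φ x ⊆ ψ x ∧ ψ x ⊆ θ x := by
  obtain ⟨W, hW, hWo, hWc, -⟩ := exists_isSieve θ hθ (fun _ => True) (fun _ _ _ _ => trivial) (by
    intro C O hC hO hCO
    obtain ⟨v, hvo, hCv, hvf, hvO⟩ := precise_refinement_set hC O hO hCO
    obtain ⟨w, hCw, hwo, hwv⟩ := exists_subset_iUnion_closure_subset hC hvo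
      (fun x _ => hvf.point_finite x) hCv
    exact ⟨w, hwo, hvf.subset fun y => subset_closure.trans (hwv y), hCw,
      fun y => (hwv y).trans (hvO y), trivial⟩)
  exact ⟨hW.limitMap, hWc.limitMap, hW.isCompact_branchLimits, hW.isLSC_limitMap hWo,
    hWc.isCompact_branchLimits, hWc.isUSC_limitMap fun s => isClosed_closure,
    fun x => ⟨branchLimits_mono (fun s => subset_closure) x, hWc.branchLimits_subset (hc x)⟩⟩

/-- Michael's zero-dimensional selection theorem. -/
theorem HasDisjointRefinements.exists_continuous_selection [CompleteSpace Y]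
    (hX : HasDisjointRefinements X) (θ : SetValuedMap X Y) (hθ : θ.IsLSC) (hc : θ.ClosedValued) :
    ∃ g : X → Y, Continuous g ∧ ∀ x, g x ∈ θ x := by
  obtain ⟨W, hW, hWo, -, hWd⟩ := exists_isSieve θ hθ
    (fun W => Pairwise (Function.onFun Disjoint W))
    (fun W W' hWW' hW y z hyz => (hW hyz).mono (hWW' y) (hWW' z)) (by
      intro C O hC hO hCO
      obtain ⟨v, hvo, hvO, hvc, hvd⟩ := hX (Option Y) (fun o => o.elim Cᶜ O)
        (by rintro (_ | y); exacts [hC.isOpen_compl, hO y])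
        (eq_univ_of_forall fun x => by
          by_cases hx : x ∈ C
          · obtain ⟨y, hy⟩ := mem_iUnion.1 (hCO hx)
            exact mem_iUnion.2 ⟨some y, hy⟩
          · exact mem_iUnion.2 ⟨none, hx⟩)
      have hmem : ∀ x, ∃ o, x ∈ v o := fun x => by
        have hx : x ∈ ⋃ o, v o := hvc ▸ mem_univ x
        exact mem_iUnion.1 hx
      -- The members of a disjoint open cover are clopen.
      have hclosed : ∀ o, IsClosed (v o) := by
        intro o
        have : (v o)ᶜ = ⋃ o' ∈ ({o}ᶜ : Set (Option Y)), v o' := by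
          ext x
          constructor
          · intro hx
            obtain ⟨o', ho'⟩ := hmem x
            exact mem_biUnion (x := o') (fun h : o' = o => hx (h ▸ ho')) ho'
          · intro hx hxo
            obtain ⟨o', ho', hxo'⟩ := mem_iUnion₂.1 hx
            exact Set.disjoint_left.1 (hvd ho') hxo' hxo
        rw [← isOpen_compl_iff, this]
        exact isOpen_biUnion fun o' _ => hvo o'
      refine ⟨fun y => v (some y), fun y => hvo _, fun x => ?_, fun x hx => ?_,
        fun y => (hclosed _).closure_eq.trans_subset (hvO (some y)),
        fun y z hyz => hvd fun h => hyz (Option.some.inj h)⟩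
      · obtain ⟨o, ho⟩ := hmem x
        refine ⟨v o, (hvo o).mem_nhds ho, (finite_singleton o).preimage
          (Option.some_injective Y).injOn |>.subset ?_⟩
        rintro y ⟨z, hzy, hzo⟩
        by_contra hne
        exact Set.disjoint_left.1 (hvd hne) hzy hzo
      · obtain ⟨_ | y, ho⟩ := hmem x
        · exact absurd hx (hvO none ho)
        · exact mem_iUnion.2 ⟨y, ho⟩)
  choose g hg using hW.branchLimits_nonempty
  refine ⟨g, continuous_def.2 fun H hH => ?_, fun x => hW.branchLimits_subset (hc x) (hg x)⟩
  convert (SetValuedMap.isLSC_iff _).1 (hW.isLSC_limitMap hWo) H hH using 1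
  ext x
  constructor
  · exact fun hx => ⟨g x, hg x, hx⟩
  · rintro ⟨p, hp, hpH⟩
    rw [hW.branchLimits_subsingleton hWd x hp (hg x)] at hpH
    exact hpH

end Sieves

/-! ### Cardinal estimates, weight and degree of compactness -/

section CardinalFunctions

variable {X : Type u}

/-- A non-sequential cardinal is not reached by countable unions of smaller sets. -/
theorem mk_iUnion_nat_lt {τ : Cardinal.{u}} (hτ : ℵ₀ < τ) (hseq : ¬ IsSequential τ)
    {f : ℕ → Set X} (hf : ∀ n, #(f n) < τ) : #(⋃ n, f n) < τ := by
  have hsup : ⨆ n, #(f n) < τ :=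
    lt_of_le_of_ne (ciSup_le' fun n => (hf n).le) fun h => hseq ⟨_, hf, h⟩
  have h := Cardinal.mk_iUnion_le_lift f
  simp only [Cardinal.lift_uzero, Cardinal.mk_nat, Cardinal.lift_aleph0] at h
  exact h.trans_lt (Cardinal.mul_lt_of_lt hτ.le hτ hsup)

theorem mk_biUnion_finite_lt {τ : Cardinal.{u}} (hτ : ℵ₀ < τ) {ι : Type u} {s : Set ι}
    (hs : #s < τ) {f : ι → Set X} (hf : ∀ i ∈ s, (f i).Finite) : #(⋃ i ∈ s, f i) < τ := by
  have hsup : ⨆ i : s, #(f i) ≤ ℵ₀ :=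
    ciSup_le' fun i => (Cardinal.lt_aleph0_iff_set_finite.2 (hf i i.2)).le
  exact (Cardinal.mk_biUnion_le f s).trans_lt
    (Cardinal.mul_lt_of_lt hτ.le hs (hsup.trans_lt hτ))

variable [TopologicalSpace X]

theorem exists_basis_mk_eq_weight (X : Type u) [TopologicalSpace X] :
    ∃ B : Set (Set X), TopologicalSpace.IsTopologicalBasis B ∧ #B = weight X :=
  csInf_mem (s := {m | ∃ B : Set (Set X), TopologicalSpace.IsTopologicalBasis B ∧ #B = m})
    ⟨_, _, TopologicalSpace.isTopologicalBasis_opens, rfl⟩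

theorem weight_le_mk {B : Set (Set X)} (hB : TopologicalSpace.IsTopologicalBasis B) :
    weight X ≤ #B :=
  csInf_le' ⟨B, hB, rfl⟩

theorem weight_mono {A B : Set X} (hAB : A ⊆ B) : weight A ≤ weight B := by
  obtain ⟨𝓑, h𝓑, hcard⟩ := exists_basis_mk_eq_weight B
  rw [← hcard]
  exact (weight_le_mk (h𝓑.isInducing (Topology.IsInducing.of_comp (g := Subtype.val)
    (continuous_inclusion hAB) continuous_subtype_val Topology.IsInducing.subtypeVal))).trans
    Cardinal.mk_image_le

theorem mk_le_weight [DiscreteTopology X] : #X ≤ weight X := by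
  obtain ⟨𝓑, h𝓑, hcard⟩ := exists_basis_mk_eq_weight X
  rw [← hcard]
  have hmem : ∀ x : X, {x} ∈ 𝓑 := fun x => by
    obtain ⟨V, hV, hxV, hVx⟩ := h𝓑.exists_subset_of_mem_open (mem_singleton x)
      (isOpen_discrete {x})
    rwa [← Subset.antisymm hVx (singleton_subset_iff.2 hxV)]
  exact Cardinal.mk_le_of_injective (f := fun x => (⟨{x}, hmem x⟩ : 𝓑))
    fun x y hxy => singleton_injective (congrArg Subtype.val hxy)

theorem exists_refinement_mk_lt {m : Cardinal.{u}} (hX : compactnessDegree X ≤ m)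
    {𝒰 : Set (Set X)} (h𝒰 : IsOpenCover 𝒰) :
    ∃ 𝒱 : Set (Set X), IsOpenCover 𝒱 ∧ Refines 𝒱 𝒰 ∧ #𝒱 < m := by
  have hne : {m : Cardinal.{u} | ∀ 𝒰 : Set (Set X), IsOpenCover 𝒰 →
      ∃ 𝒱 : Set (Set X), IsOpenCover 𝒱 ∧ Refines 𝒱 𝒰 ∧ #𝒱 < m}.Nonempty :=
    ⟨Order.succ #(Set X), fun 𝒰 h𝒰 => ⟨𝒰, h𝒰, fun U hU => ⟨U, hU, Subset.rfl⟩,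
      Order.lt_succ_of_le (Cardinal.mk_set_le 𝒰)⟩⟩
  obtain ⟨𝒱, h1, h2, h3⟩ := csInf_mem hne 𝒰 h𝒰
  exact ⟨𝒱, h1, h2, h3.trans_le hX⟩

theorem mk_lt_compactnessDegree [DiscreteTopology X] : #X < compactnessDegree X := by
  obtain ⟨𝒱, ⟨-, h𝒱⟩, href, hcard⟩ := exists_refinement_mk_lt (X := X) le_rfl
    (𝒰 := range fun x : X => ({x} : Set X))
    ⟨fun _ _ => isOpen_discrete _, eq_univ_of_forall fun x => ⟨{x}, mem_range_self x, rfl⟩⟩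
  have hmem : ∀ x, {x} ∈ 𝒱 := fun x => by
    obtain ⟨V, hV, hxV⟩ : x ∈ ⋃₀ 𝒱 := h𝒱 ▸ mem_univ x
    obtain ⟨_, ⟨y, rfl⟩, hVy : V ⊆ {y}⟩ := href V hV
    obtain rfl : x = y := hVy hxV
    rwa [← Subset.antisymm hVy (singleton_subset_iff.2 hxV)]
  exact (Cardinal.mk_le_of_injective (f := fun x => (⟨{x}, hmem x⟩ : 𝒱))
    fun x y hxy => singleton_injective (congrArg Subtype.val hxy)).trans_lt hcard

theorem compactnessDegree_le_succ_weight : compactnessDegree X ≤ Order.succ (weight X) := by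
  obtain ⟨𝓑, h𝓑, hcard⟩ := exists_basis_mk_eq_weight X
  refine csInf_le' fun 𝒰 h𝒰 => ⟨{V ∈ 𝓑 | ∃ U ∈ 𝒰, V ⊆ U},
    ⟨fun V hV => h𝓑.isOpen hV.1, eq_univ_of_forall fun x => ?_⟩, fun V hV => hV.2,
    Order.lt_succ_of_le ((Cardinal.mk_le_mk_of_subset (sep_subset _ _)).trans hcard.le)⟩
  obtain ⟨U, hU, hxU⟩ : x ∈ ⋃₀ 𝒰 := h𝒰.2 ▸ mem_univ x
  obtain ⟨V, hV, hxV, hVU⟩ := h𝓑.exists_subset_of_mem_open hxU (h𝒰.1 U hU)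
  exact ⟨V, ⟨hV, U, hU, hVU⟩, hxV⟩

theorem weight_lt_of_subset_closure {Y : Type u} [MetricSpace Y] {τ : Cardinal.{u}} (hτ : ℵ₀ < τ)
    {S D : Set Y} (hS : S ⊆ closure D) (hD : #D < τ) : weight S < τ := by
  let b : D × ULift.{u} ℕ → Set S := fun q =>
    Subtype.val ⁻¹' Metric.ball (q.1 : Y) (1 / ((q.2.down : ℝ) + 1))
  have hb : TopologicalSpace.IsTopologicalBasis (range b) := by
    refine TopologicalSpace.isTopologicalBasis_of_isOpen_of_nhds ?_ fun x U hxU hU => ?_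
    · rintro _ ⟨q, rfl⟩
      exact Metric.isOpen_ball.preimage continuous_subtype_val
    · obtain ⟨ε, hε, hball⟩ := Metric.isOpen_iff.1 hU x hxU
      obtain ⟨n, hn⟩ := exists_nat_one_div_lt (half_pos hε)
      obtain ⟨d, hd, hxd⟩ := Metric.mem_closure_iff.1 (hS x.2) (1 / ((n : ℝ) + 1))
        Nat.one_div_pos_of_nat
      refine ⟨b (⟨d, hd⟩, ⟨n⟩), mem_range_self _, hxd, fun z hz => hball ?_⟩
      have hz' : dist (z : Y) d < 1 / ((n : ℝ) + 1) := hz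
      have := dist_triangle_right (z : Y) x d
      rw [Metric.mem_ball, Subtype.dist_eq]
      linarith
  refine ((weight_le_mk hb).trans Cardinal.mk_range_le).trans_lt ?_
  rw [Cardinal.mk_prod, Cardinal.lift_id, Cardinal.lift_id]
  exact Cardinal.mul_lt_of_lt hτ.le hD (by simpa using hτ)

/-- The image of a set of small degree of compactness under a compact-valued upper semi-continuous
mapping into a metric space has small density. -/
theorem exists_mk_lt_image_subset_closure {Y : Type u} [MetricSpace Y] {τ : Cardinal.{u}}
    (hτ : ℵ₀ < τ) (hseq : ¬ IsSequential τ) {K : Set X} (hK : compactnessDegree K ≤ τ)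
    (ψ : SetValuedMap X Y) (hψ : ψ.IsUSC) (hc : ψ.CompactValued) :
    ∃ D : Set Y, #D < τ ∧ ψ.image K ⊆ closure D := by
  have hn : ∀ n : ℕ, ∃ D : Set Y, #D < τ ∧
      ψ.image K ⊆ ⋃ y ∈ D, Metric.ball y (1 / ((n : ℝ) + 1)) := by
    intro n
    rcases isEmpty_or_nonempty X with hX | hX
    · exact ⟨∅, by simpa using pos_of_gt hτ, by
        rintro y hy
        obtain ⟨x, -⟩ := mem_iUnion.1 hy
        exact isEmptyElim x⟩
    choose! t htf ht using fun x => Metric.totallyBounded_iff.1 (hc x).totallyBounded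
      (1 / ((n : ℝ) + 1)) Nat.one_div_pos_of_nat
    let O : X → Set X := fun x => {z | ψ z ⊆ ⋃ y ∈ t x, Metric.ball y (1 / ((n : ℝ) + 1))}
    have hO : ∀ x, IsOpen (O x) := fun x =>
      upperHemicontinuous_iff_isOpen_preimage_Iic.1 hψ _
        (isOpen_biUnion fun y _ => Metric.isOpen_ball)
    obtain ⟨𝒱, ⟨-, h𝒱⟩, href, hcard⟩ := exists_refinement_mk_lt hK
      (𝒰 := range fun x : X => (Subtype.val ⁻¹' O x : Set K))
      ⟨by rintro _ ⟨x, rfl⟩; exact (hO x).preimage continuous_subtype_val,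
        eq_univ_of_forall fun x => ⟨_, mem_range_self (x : X), ht x⟩⟩
    have hpick : ∀ V ∈ 𝒱, ∃ x : X, V ⊆ Subtype.val ⁻¹' O x := fun V hV => by
      obtain ⟨_, ⟨x, rfl⟩, hx⟩ := href V hV
      exact ⟨x, hx⟩
    choose! c hc using hpick
    refine ⟨⋃ V ∈ 𝒱, t (c V), mk_biUnion_finite_lt hτ hcard fun V _ => htf _, fun y hy => ?_⟩
    obtain ⟨x, hxK, hyx⟩ := mem_iUnion₂.1 hy
    obtain ⟨V, hV, hxV⟩ : (⟨x, hxK⟩ : K) ∈ ⋃₀ 𝒱 := h𝒱 ▸ mem_univ _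
    obtain ⟨z, hz, hyz⟩ := mem_iUnion₂.1 (hc V hV hxV hyx)
    exact mem_biUnion (mem_biUnion hV hz) hyz
  choose D hD hψD using hn
  refine ⟨⋃ n, D n, mk_iUnion_nat_lt hτ hseq hD, fun y hy => Metric.mem_closure_iff.2 ?_⟩
  intro ε hε
  obtain ⟨n, hn⟩ := exists_nat_one_div_lt hε
  obtain ⟨z, hz, hyz⟩ := mem_iUnion₂.1 (hψD n hy)
  exact ⟨z, mem_iUnion.2 ⟨n, hz⟩, (Metric.mem_ball.1 hyz).trans hn⟩

end CardinalFunctions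

/-! ### Large discrete families at the cozero-dimensional kernel -/

section DiscreteFamilies

variable {X : Type u} [TopologicalSpace X] [ParacompactSpace X]

/-- Paracompact spaces are collectionwise normal with respect to points. -/
theorem exists_disjoint_locallyFinite_nhds [T2Space X] {D : Set X}
    (hD : LocallyFinite fun d : D => ({(d : X)} : Set X)) :
    ∃ V : D → Set X, (∀ d, IsOpen (V d)) ∧ (∀ d : D, (d : X) ∈ V d) ∧
      Pairwise (Function.onFun Disjoint V) ∧ LocallyFinite V := by
  rcases isEmpty_or_nonempty D with hE | ⟨⟨d₀⟩⟩
  · exact ⟨isEmptyElim, isEmptyElim, isEmptyElim, isEmptyElim, fun x => ⟨univ, Filter.univ_mem,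
      Set.toFinite _⟩⟩
  have hclosed : ∀ d : D, IsClosed (⋃ e : {e : D // e ≠ d}, ({(e : X)} : Set X)) := fun d =>
    (hD.comp_injective Subtype.val_injective).isClosed_iUnion fun e => isClosed_singleton
  obtain ⟨v, hvo, hvc, hvf, hv⟩ := precise_refinement
    (fun d : D => (⋃ e : {e : D // e ≠ d}, ({(e : X)} : Set X))ᶜ)
    (fun d => (hclosed d).isOpen_compl)
    (eq_univ_of_forall fun x => by
      by_cases hx : x ∈ D
      · refine mem_iUnion.2 ⟨⟨x, hx⟩, ?_⟩
        simp only [mem_compl_iff, mem_iUnion, not_exists, mem_singleton_iff]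
        exact fun e he => e.2 (Subtype.ext he.symm)
      · refine mem_iUnion.2 ⟨d₀, ?_⟩
        simp only [mem_compl_iff, mem_iUnion, not_exists, mem_singleton_iff]
        exact fun e he => hx (he ▸ e.1.2))
  obtain ⟨w, hwc, hw, hwv⟩ := exists_iUnion_eq_closed_subset hvo (fun x => hvf.point_finite x) hvc
  have hwf : LocallyFinite w := hvf.subset hwv
  have hdw : ∀ d e : D, (d : X) ∈ w e → d = e := by
    intro d e hde
    by_contra hne
    exact hv e (hwv e hde) (mem_iUnion.2 ⟨⟨d, hne⟩, rfl⟩)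
  have hVw : ∀ d, (⋃ e : {e : D // e ≠ d}, w e)ᶜ ⊆ w d := by
    intro d x hx
    obtain ⟨e, he⟩ : ∃ e, x ∈ w e := mem_iUnion.1 (hwc ▸ mem_univ x : x ∈ ⋃ e, w e)
    by_cases hed : e = d
    · exact hed ▸ he
    · exact absurd (mem_iUnion.2 ⟨⟨e, hed⟩, he⟩) hx
  refine ⟨fun d => (⋃ e : {e : D // e ≠ d}, w e)ᶜ, fun d =>
    ((hwf.comp_injective Subtype.val_injective).isClosed_iUnion fun e => hw e.1).isOpen_compl,
    fun d hd => ?_, fun d e hde => ?_, hwf.subset hVw⟩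
  · obtain ⟨e, he⟩ := mem_iUnion.1 hd
    exact e.2 (hdw d e he).symm
  · rw [Function.onFun, Set.disjoint_left]
    exact fun x hxd hxe => hxe (mem_iUnion.2 ⟨⟨d, hde⟩, hVw d hxd⟩)

/-- To bound the degree of compactness of a closed set it suffices to bound its closed discrete
subsets: take a maximal set of points no two of which lie in a common member of a locally finite
cover. -/
theorem compactnessDegree_le_of_forall_discrete {τ : Cardinal.{u}} (hτ : ℵ₀ < τ) {K : Set X}
    (hK : IsClosed K)
    (h : ∀ D ⊆ K, (LocallyFinite fun d : D => ({(d : X)} : Set X)) → #D < τ) :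
    compactnessDegree K ≤ τ := by
  refine csInf_le' fun 𝒰 h𝒰 => ?_
  choose O hOo hO using fun U : 𝒰 => isOpen_induced_iff.1 (h𝒰.1 U U.2)
  obtain ⟨W, hWo, hKW, hWf, hWO⟩ := precise_refinement_set hK O hOo (fun x hx => by
    obtain ⟨U, hU, hxU⟩ : (⟨x, hx⟩ : K) ∈ ⋃₀ 𝒰 := h𝒰.2 ▸ mem_univ _
    exact mem_iUnion.2 ⟨⟨U, hU⟩, (hO ⟨U, hU⟩).symm.subset hxU⟩)
  let 𝒟 : Set (Set X) := {D | D ⊆ K ∧ ∀ i, ∀ x ∈ D, ∀ y ∈ D, x ∈ W i → y ∈ W i → x = y}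
  obtain ⟨D, hDmax⟩ := zorn_subset 𝒟 (fun c hc hchain => by
    refine ⟨⋃₀ c, ⟨sUnion_subset fun D hD => (hc hD).1, ?_⟩, fun D hD => subset_sUnion_of_mem hD⟩
    rintro i x ⟨D, hD, hxD⟩ y ⟨E, hE, hyE⟩ hx hy
    rcases hchain.total hD hE with hDE | hED
    · exact (hc hE).2 i x (hDE hxD) y hyE hx hy
    · exact (hc hD).2 i x hxD y (hED hyE) hx hy)
  obtain ⟨hDK, hDW⟩ := hDmax.prop
  have hDf : LocallyFinite fun d : D => ({(d : X)} : Set X) := by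
    intro x
    by_cases hx : x ∈ K
    · obtain ⟨i, hi⟩ := mem_iUnion.1 (hKW hx)
      refine ⟨W i, (hWo i).mem_nhds hi, Set.Subsingleton.finite ?_⟩
      rintro d ⟨_, rfl, hd⟩ e ⟨_, rfl, he⟩
      exact Subtype.ext (hDW i d d.2 e e.2 hd he)
    · refine ⟨Kᶜ, hK.isOpen_compl.mem_nhds hx, finite_empty.subset ?_⟩
      rintro d ⟨_, rfl, hd⟩
      exact hd (hDK d.2)
  let J : Set 𝒰 := ⋃ d ∈ D, {i | d ∈ W i}
  have hJ : #J < τ := mk_biUnion_finite_lt hτ (h D hDK hDf) fun d _ => hWf.point_finite d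
  have hKJ : ∀ x ∈ K, ∃ i ∈ J, x ∈ W i := by
    intro x hx
    by_contra! hno
    have hins : insert x D ∈ 𝒟 := by
      refine ⟨insert_subset hx hDK, ?_⟩
      rintro i y (rfl | hy) z (rfl | hz) hyi hzi
      · rfl
      · exact absurd hyi (hno i (mem_biUnion (x := z) hz hzi))
      · exact absurd hzi (hno i (mem_biUnion (x := y) hy hyi))
      · exact hDW i y hy z hz hyi hzi
    have hxD : x ∈ D := hDmax.le_of_ge hins (subset_insert x D) (mem_insert x D)
    obtain ⟨i, hi⟩ := mem_iUnion.1 (hKW hx)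
    exact hno i (mem_biUnion (x := x) hxD hi) hi
  refine ⟨(fun i => Subtype.val ⁻¹' W i) '' J, ⟨?_, eq_univ_of_forall fun x => ?_⟩, ?_,
    Cardinal.mk_image_le.trans_lt hJ⟩
  · rintro _ ⟨i, -, rfl⟩
    exact (hWo i).preimage continuous_subtype_val
  · obtain ⟨i, hi, hxi⟩ := hKJ x x.2
    exact ⟨_, ⟨i, hi, rfl⟩, hxi⟩
  · rintro _ ⟨i, -, rfl⟩
    exact ⟨i, i.2, (preimage_mono (hWO i)).trans (hO i).subset⟩

/-- Each point `d` of a closed discrete subset of the cozero-dimensional kernel has disjoint closed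
sets `A d`, `B d` near it that no clopen set separates.  A mapping into `Option D` that is `{none}`
on `A d` and `{some d}` on `B d` forces every upper semi-continuous selection to take the values
`none` and `some d` at a common point, so that all of `D` lies in one largest image. -/
theorem mk_lt_of_usc_selection [T2Space X] {τ : Cardinal.{u}} (hτ : 0 < τ) {D : Set X}
    (hDK : D ⊆ cozeroKernel X) (hD : LocallyFinite fun d : D => ({(d : X)} : Set X))
    (h : ∀ (Y : Type u) [TopologicalSpace Y] [DiscreteTopology Y] (θ : SetValuedMap X Y), θ.IsLSC →
      ∃ ψ : SetValuedMap X Y, ψ.IsSelection θ ∧ ψ.IsUSC ∧ ∀ x : X, #(ψ.largestImage {x}) < τ) :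
    #D < τ := by
  rcases isEmpty_or_nonempty D with hE | ⟨⟨d₀⟩⟩
  · rwa [Cardinal.mk_eq_zero]
  obtain ⟨V, hVo, hdV, hVd, hVf⟩ := exists_disjoint_locallyFinite_nhds hD
  have hAB : ∀ d : D, ∃ A B : Set X, IsClosed A ∧ IsClosed B ∧ A ⊆ V d ∧ B ⊆ V d ∧
      Disjoint A B ∧ ∀ C, IsClopen C → A ⊆ C → ¬ Disjoint B C := by
    intro d
    by_contra! hno
    exact hDK d.2 (mem_zeroDimPart_of_clopen_separation (hVo d) (hdV d) hno)
  choose A B hA hB hAV hBV hdis hsep using hAB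
  have huniq : ∀ {x d e}, x ∈ V d → x ∈ V e → d = e := fun {x d e} hd he => by
    by_contra hne
    exact Set.disjoint_left.1 (hVd hne) hd he
  let _ : TopologicalSpace (Option D) := ⊥
  have : DiscreteTopology (Option D) := ⟨rfl⟩
  let E : Option D → Set X := fun o => o.elim (⋃ d, B d)ᶜ fun d => V d \ A d
  have hE : ∀ o, IsOpen (E o) := by
    rintro (_ | d)
    · exact ((hVf.subset hBV).isClosed_iUnion hB).isOpen_compl
    · exact (hVo d).sdiff (hA d)
  let θ : SetValuedMap X (Option D) := ⟨fun x => {o | x ∈ E o}, fun x => by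
    by_cases hx : x ∈ ⋃ d, B d
    · obtain ⟨d, hd⟩ := mem_iUnion.1 hx
      exact ⟨some d, hBV d hd, fun hxA => Set.disjoint_left.1 (hdis d) hxA hd⟩
    · exact ⟨none, hx⟩⟩
  obtain ⟨ψ, hψ, hu, hcard⟩ := h (Option D) θ ((SetValuedMap.isLSC_iff _).2 fun H _ => by
    have : θ.preimage H = ⋃ o ∈ H, E o := by
      ext x
      simp only [SetValuedMap.preimage, Set.Nonempty, mem_ofPred_eq, mem_iUnion, mem_inter_iff,
        exists_prop]
      exact ⟨fun ⟨o, h1, h2⟩ => ⟨o, h2, h1⟩, fun ⟨o, h1, h2⟩ => ⟨o, h2, h1⟩⟩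
    rw [this]
    exact isOpen_biUnion fun o _ => hE o)
  rw [SetValuedMap.isUSC_iff] at hu
  have hlink : ∀ d : D, ∃ x, none ∈ ψ x ∧ some d ∈ ψ x := by
    intro d
    by_contra! hno
    have hcompl : (ψ.preimage {some d})ᶜ = ψ.preimage {some d}ᶜ := by
      ext x
      constructor
      · intro hx
        obtain ⟨o, ho⟩ := ψ.nonempty' x
        exact ⟨o, ho, fun hod : o = some d => hx ⟨o, ho, hod⟩⟩
      · rintro ⟨_ | e, he, hed⟩ ⟨_, hd, rfl⟩
        · exact hno x he hd
        · exact hed (congrArg some (huniq (hψ x he).1 (hψ x hd).1))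
    have hclopen : IsClopen (ψ.preimage {some d})ᶜ :=
      ⟨hcompl ▸ hu _ (isClosed_discrete _), (hu _ (isClosed_discrete _)).isOpen_compl⟩
    refine hsep d _ hclopen ?_ ?_
    · rintro x hxA ⟨_, hd, rfl⟩
      exact (hψ x hd).2 hxA
    · rw [Set.disjoint_left]
      intro x hxB hx
      obtain ⟨_ | e, he⟩ := ψ.nonempty' x
      · exact hψ x he (mem_iUnion.2 ⟨d, hxB⟩)
      · obtain rfl := huniq (hψ x he).1 (hBV d hxB)
        exact hx ⟨_, he, rfl⟩
  obtain ⟨x₀, hx₀, -⟩ := hlink d₀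
  have hsub : range (some : D → Option D) ⊆ ψ.largestImage {x₀} := by
    rintro _ ⟨d, rfl⟩
    obtain ⟨x, hx, hxd⟩ := hlink d
    exact mem_iUnion.2 ⟨1, mem_biUnion (x := x) ⟨none, hx, mem_biUnion rfl hx₀⟩ hxd⟩
  rw [← Cardinal.mk_range_eq _ (Option.some_injective D)]
  exact (Cardinal.mk_le_mk_of_subset hsub).trans_lt (hcard x₀)

end DiscreteFamilies

/-! ### Selections that are small on the cozero-dimensional kernel -/

section Selections

theorem largestImage_singleton_subset {X Y : Type u} {ψ : SetValuedMap X Y} {x : X} {S : Set Y}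
    (hx : ψ x ⊆ S) (hS : ∀ z, (ψ z ∩ S).Nonempty → ψ z ⊆ S) : ψ.largestImage {x} ⊆ S := by
  refine iUnion_subset fun n => ?_
  induction n with
  | zero => simpa [SetValuedMap.iterImage, SetValuedMap.image] using hx
  | succ n ih =>
    exact iUnion₂_subset fun z hz => hS z (hz.mono (inter_subset_inter_right _ ih))

/-- If `ψ` is single-valued off `H`, a largest image is a single point or lies in the image of
`H`. -/
theorem compactnessDegree_largestImage_le {X Y : Type u} [MetricSpace Y] {τ : Cardinal.{u}}
    (hτ : ℵ₀ < τ) {H : Set X} {ψ : SetValuedMap X Y} (hH : weight (ψ.image H) < τ)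
    (hψ : ∀ x ∈ Hᶜ, ∃ y : Y, ψ x = {y}) (x : X) :
    ∃ m < τ, compactnessDegree (ψ.largestImage {x}) ≤ Order.succ m := by
  refine ⟨weight (ψ.largestImage {x}), ?_, compactnessDegree_le_succ_weight⟩
  have hsat : ∀ z, (ψ z ∩ ψ.image H).Nonempty → ψ z ⊆ ψ.image H := by
    rintro z ⟨y, hyz, hyH⟩
    by_cases hz : z ∈ H
    · exact subset_biUnion_of_mem (u := fun x => ψ x) hz
    · obtain ⟨y', hy'⟩ := hψ z hz
      rw [hy'] at hyz ⊢
      obtain rfl := hyz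
      exact singleton_subset_iff.2 hyH
  by_cases hx : (ψ x ∩ ψ.image H).Nonempty
  · exact (weight_mono (largestImage_singleton_subset (hsat x hx) hsat)).trans_lt hH
  · have hout : ∀ z, z ∈ H → ψ z ⊆ ψ.image H := fun z hz =>
      subset_biUnion_of_mem (u := fun x => ψ x) hz
    have hxH : x ∉ H := fun hxH => hx ((ψ.nonempty' x).mono fun y hy => ⟨hy, hout x hxH hy⟩)
    obtain ⟨y, hy⟩ := hψ x hxH
    have hsub : ψ.largestImage {x} ⊆ {y} := by
      refine largestImage_singleton_subset hy.subset ?_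
      rintro z ⟨_, hyz, rfl⟩
      by_cases hz : z ∈ H
      · exact absurd ⟨_, hy.symm.subset rfl, hout z hz hyz⟩ hx
      · obtain ⟨y', hy'⟩ := hψ z hz
        rw [hy'] at hyz ⊢
        rw [mem_singleton_iff.1 hyz]
    exact weight_lt_of_subset_closure hτ (hsub.trans subset_closure)
      (by rw [Cardinal.mk_singleton]; exact Cardinal.one_lt_aleph0.trans hτ)

variable {X Y : Type u} [TopologicalSpace X] {τ : Cardinal.{u}}

theorem exists_selections_small_on_cozeroKernel [T2Space X] [ParacompactSpace X] (hτ : ℵ₀ < τ)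
    (hseq : ¬ IsSequential τ) (hK : compactnessDegree (cozeroKernel X) ≤ τ) [MetricSpace Y]
    [CompleteSpace Y] (θ : SetValuedMap X Y) (hθ : θ.IsLSC) (hc : θ.ClosedValued) :
    ∃ φ ψ : SetValuedMap X Y, φ.CompactValued ∧ φ.IsLSC ∧ ψ.CompactValued ∧ ψ.IsUSC ∧
      (∀ x, φ x ⊆ ψ x ∧ ψ x ⊆ θ x) ∧
      ∃ D : Set Y, #D < τ ∧ ψ.image (cozeroKernel X) ⊆ closure D := by
  obtain ⟨φ, ψ, hφc, hφ, hψc, hψ, hsub⟩ := exists_lsc_usc_selection θ hθ hc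
  exact ⟨φ, ψ, hφc, hφ, hψc, hψ, hsub, exists_mk_lt_image_subset_closure hτ hseq hK ψ hψ hψc⟩

/-- Replacing the values off the cozero-dimensional kernel by the closure of the image of the
kernel, one makes the whole image of the upper semi-continuous mapping small. -/
theorem exists_selections_of_small_image [T2Space X] [ParacompactSpace X] (hτ : ℵ₀ < τ)
    (hseq : ¬ IsSequential τ) (hK : compactnessDegree (cozeroKernel X) ≤ τ) [MetricSpace Y]
    [CompleteSpace Y] (θ : SetValuedMap X Y) (hθ : θ.IsLSC) (hc : θ.ClosedValued) :
    ∃ φ ψ : SetValuedMap X Y, φ.CompactValued ∧ φ.IsLSC ∧ ψ.CompactValued ∧ ψ.IsUSC ∧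
      weight (ψ.image univ) < τ ∧ ∀ x ∈ cozeroKernel X, φ x ⊆ ψ x ∧ ψ x ⊆ θ x := by
  classical
  obtain ⟨φ₀, ψ₀, hφ₀c, hφ₀, -, -, hsub₀, D, hD, hψD⟩ :=
    exists_selections_small_on_cozeroKernel hτ hseq hK θ hθ hc
  have hφD : φ₀.image (cozeroKernel X) ⊆ closure D :=
    (iUnion₂_mono fun x _ => (hsub₀ x).1).trans hψD
  rcases isEmpty_or_nonempty X with hX | ⟨⟨x₀⟩⟩
  · refine ⟨θ, θ, fun x => isEmptyElim x, hθ, fun x => isEmptyElim x,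
      (SetValuedMap.isUSC_iff θ).2 fun H _ => ?_, ?_, fun x => isEmptyElim x⟩
    · rw [Set.eq_empty_of_isEmpty (θ.preimage H)]
      exact isClosed_empty
    · refine weight_lt_of_subset_closure hτ (D := D) (fun y hy => ?_) hD
      obtain ⟨x, -⟩ := mem_iUnion.1 hy
      exact isEmptyElim x
  obtain ⟨y₀, -⟩ := θ.nonempty' x₀
  -- The point `y₀` only matters when the kernel is empty.
  let L : Set Y := closure (insert y₀ D)
  have hφL : ∀ x ∈ cozeroKernel X, φ₀ x ⊆ L := fun x hx y hy =>
    closure_mono (subset_insert _ _) (hφD (mem_biUnion hx hy))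
  let θ' : SetValuedMap X Y := ⟨fun x => if x ∈ cozeroKernel X then φ₀ x else L, fun x => by
    split_ifs
    · exact φ₀.nonempty' x
    · exact ⟨y₀, subset_closure (mem_insert _ _)⟩⟩
  have hθ'K : ∀ x ∈ cozeroKernel X, θ' x = φ₀ x := fun x hx => if_pos hx
  have hθ'L : ∀ x, θ' x ⊆ L := fun x => by
    by_cases hx : x ∈ cozeroKernel X
    · exact (hθ'K x hx).trans_subset (hφL x hx)
    · exact (if_neg hx : θ' x = L).subset
  have hθ' : θ'.IsLSC := by
    rw [SetValuedMap.isLSC_iff] at hφ₀ ⊢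
    intro H hH
    by_cases hHL : (L ∩ H).Nonempty
    · have : θ'.preimage H = φ₀.preimage H ∪ (cozeroKernel X)ᶜ := by
        ext x
        by_cases hx : x ∈ cozeroKernel X
        · simp [SetValuedMap.preimage, hθ'K x hx, hx]
        · simpa [SetValuedMap.preimage, hx, θ'] using hHL
      rw [this]
      exact (hφ₀ H hH).union isClosed_cozeroKernel.isOpen_compl
    · have : θ'.preimage H = ∅ := by
        refine eq_empty_of_forall_notMem fun x hx => hHL ?_
        exact hx.mono (inter_subset_inter_left _ (hθ'L x))
      rw [this]
      exact isOpen_empty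
  have hθ'c : θ'.ClosedValued := fun x => by
    by_cases hx : x ∈ cozeroKernel X
    · rw [hθ'K x hx]
      exact (hφ₀c x).isClosed
    · rw [show θ' x = L from if_neg hx]
      exact isClosed_closure
  obtain ⟨φ, ψ, hφc, hφ, hψc, hψ, hsub⟩ := exists_lsc_usc_selection θ' hθ' hθ'c
  refine ⟨φ, ψ, hφc, hφ, hψc, hψ, weight_lt_of_subset_closure hτ (D := insert y₀ D) ?_ ?_,
    fun x hx => ⟨(hsub x).1, (hsub x).2.trans ?_⟩⟩
  · exact iUnion₂_subset fun x _ => (hsub x).2.trans (hθ'L x)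
  · exact Cardinal.mk_insert_le.trans_lt
      (Cardinal.add_lt_of_lt hτ.le hD (Cardinal.one_lt_aleph0.trans hτ))
  · rw [hθ'K x hx]
    exact (hsub₀ x).1.trans (hsub₀ x).2

/-- The upper semi-continuous selection `ψ₀` is kept on the intersection `H` of clopen
neighbourhoods `G n` of the kernel whose images lie in shrinking neighbourhoods of the image of the
kernel.  Off `H` it is replaced by a continuous selection of the lower semi-continuous mapping below
it, which preserves upper semi-continuity. -/
theorem exists_usc_selection_single_valued_off [T2Space X] [ParacompactSpace X] (hτ : ℵ₀ < τ)
    (hseq : ¬ IsSequential τ) (hK : compactnessDegree (cozeroKernel X) ≤ τ) [MetricSpace Y]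
    [CompleteSpace Y] (θ : SetValuedMap X Y) (hθ : θ.IsLSC) (hc : θ.ClosedValued) :
    ∃ (H : Set X) (ψ : SetValuedMap X Y), IsClosed H ∧ IsGδ H ∧
      ψ.IsSelection θ ∧ ψ.IsUSC ∧ ψ.CompactValued ∧
      (cozeroKernel X ⊆ H ∧ weight (ψ.image H) < τ) ∧
      (∀ x ∈ Hᶜ, ∃ y : Y, ψ x = {y}) ∧
      closure (ψ.image H) = closure (ψ.image (cozeroKernel X)) := by
  classical
  obtain ⟨φ, ψ₀, hφc, hφ, hψ₀c, hψ₀, hsub, D, hD, hψD⟩ :=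
    exists_selections_small_on_cozeroKernel hτ hseq hK θ hθ hc
  let S : Set Y := ψ₀.image (cozeroKernel X)
  have hG : ∀ n : ℕ, ∃ G, IsClopen G ∧ cozeroKernel X ⊆ G ∧
      G ⊆ {x | ψ₀ x ⊆ Metric.thickening (1 / ((n : ℝ) + 1)) S} := fun n =>
    exists_isClopen_cozeroKernel_subset
      (upperHemicontinuous_iff_isOpen_preimage_Iic.1 hψ₀ _ Metric.isOpen_thickening)
      fun x hx => (subset_biUnion_of_mem (u := fun x => ψ₀ x) hx).trans
        (Metric.self_subset_thickening Nat.one_div_pos_of_nat S)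
  choose G hGc hKG hGS using hG
  let H : Set X := ⋂ n, G n
  have hKH : cozeroKernel X ⊆ H := subset_iInter hKG
  have hHc : IsClosed H := isClosed_iInter fun n => (hGc n).1
  have hφ' : (⟨fun x => φ x, fun x => φ.nonempty' x⟩ : SetValuedMap (Hᶜ : Set X) Y).IsLSC := by
    rw [SetValuedMap.isLSC_iff] at hφ ⊢
    exact fun U hU => (hφ U hU).preimage continuous_subtype_val
  obtain ⟨g, hg, hgφ⟩ := (hasDisjointRefinements_compl_iInter hGc hKG).exists_continuous_selection
    _ hφ' fun x => (hφc x).isClosed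
  let ψ : SetValuedMap X Y := ⟨fun x => if hx : x ∈ H then ψ₀ x else {g ⟨x, hx⟩}, fun x => by
    split_ifs
    · exact ψ₀.nonempty' x
    · exact singleton_nonempty _⟩
  have hψH : ∀ x ∈ H, ψ x = ψ₀ x := fun x hx => dif_pos hx
  have hψg : ∀ x (hx : x ∉ H), ψ x = {g ⟨x, hx⟩} := fun x hx => dif_neg hx
  have hψψ₀ : ∀ x, ψ x ⊆ ψ₀ x := fun x => by
    by_cases hx : x ∈ H
    · exact (hψH x hx).subset
    · rw [hψg x hx, singleton_subset_iff]
      exact (hsub x).1 (hgφ ⟨x, hx⟩)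
  have himage : ∀ A ⊆ H, ψ.image A = ψ₀.image A := fun A hA =>
    iUnion₂_congr fun x hx => hψH x (hA hx)
  have hHS : ψ.image H ⊆ closure S := by
    intro y hy
    obtain ⟨x, hx, hyx⟩ := mem_iUnion₂.1 hy
    rw [Metric.mem_closure_iff]
    intro ε hε
    obtain ⟨n, hn⟩ := exists_nat_one_div_lt hε
    obtain ⟨z, hz, hyz⟩ := Metric.mem_thickening_iff.1
      (hGS n (mem_iInter.1 hx n) (hψψ₀ x hyx))
    exact ⟨z, hz, hyz.trans hn⟩
  refine ⟨H, ψ, hHc, .iInter fun n => (hGc n).2.isGδ, fun x => (hψψ₀ x).trans (hsub x).2, ?_,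
    fun x => ?_, ⟨hKH, weight_lt_of_subset_closure hτ
      (hHS.trans (closure_minimal hψD isClosed_closure)) hD⟩, fun x hx => ⟨_, hψg x hx⟩, ?_⟩
  · unfold SetValuedMap.IsUSC at hψ₀ ⊢
    rw [upperHemicontinuous_iff_forall_isOpen] at hψ₀ ⊢
    intro x U hU hxU
    by_cases hx : x ∈ H
    · filter_upwards [hψ₀ x U hU ((hψH x hx).symm.trans_subset hxU)] with z hz
      exact (hψψ₀ z).trans hz
    · have hopen := hHc.isOpen_compl.isOpenMap_subtype_val _ (hU.preimage hg)
      have hmem : x ∈ Subtype.val '' (g ⁻¹' U) :=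
        ⟨⟨x, hx⟩, hxU ((hψg x hx).symm.subset rfl), rfl⟩
      filter_upwards [hopen.mem_nhds hmem]
      rintro _ ⟨z, hz, rfl⟩
      rw [hψg z z.2, singleton_subset_iff]
      exact hz
  · by_cases hx : x ∈ H
    · rw [hψH x hx]
      exact hψ₀c x
    · rw [hψg x hx]
      exact isCompact_singleton
  · refine Subset.antisymm (closure_minimal ?_ isClosed_closure)
      (closure_mono (biUnion_subset_biUnion_left hKH))
    rw [himage _ hKH]
    exact hHS

/-- Single-valued selections of `x ↦ {U ∈ 𝒰 | x ∈ U}` with few values on `K` select small subcovers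
of open covers `𝒰` of `K`. -/
theorem compactnessDegree_le_of_discrete_selection {K : Set X} (hK : IsClosed K)
    (h : ∀ (Y : Type u) [TopologicalSpace Y] [DiscreteTopology Y] (θ : SetValuedMap X Y), θ.IsLSC →
      ∃ g : X → Y, SetValuedMap.IsSingleValuedSelection g θ ∧ #(g '' K) < τ) :
    compactnessDegree K ≤ τ := by
  refine csInf_le' fun 𝒰 h𝒰 => ?_
  choose O hOo hO using fun U : 𝒰 => isOpen_induced_iff.1 (h𝒰.1 U U.2)
  -- The complement of `K` is added to the cover under the index `none`.
  let E : Option 𝒰 → Set X := fun o => o.elim Kᶜ O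
  have hE : ∀ o, IsOpen (E o) := by
    rintro (_ | U)
    exacts [hK.isOpen_compl, hOo U]
  let _ : TopologicalSpace (Option 𝒰) := ⊥
  have : DiscreteTopology (Option 𝒰) := ⟨rfl⟩
  let θ : SetValuedMap X (Option 𝒰) := ⟨fun x => {o | x ∈ E o}, fun x => by
    by_cases hx : x ∈ K
    · obtain ⟨U, hU, hxU⟩ : (⟨x, hx⟩ : K) ∈ ⋃₀ 𝒰 := h𝒰.2 ▸ mem_univ _
      exact ⟨some ⟨U, hU⟩, (hO ⟨U, hU⟩).symm.subset hxU⟩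
    · exact ⟨none, hx⟩⟩
  obtain ⟨g, hg, hcard⟩ := h (Option 𝒰) θ ((SetValuedMap.isLSC_iff _).2 fun H _ => by
    have : θ.preimage H = ⋃ o ∈ H, E o := by
      ext x
      simp only [SetValuedMap.preimage, Set.Nonempty, mem_ofPred_eq, mem_iUnion, mem_inter_iff,
        exists_prop]
      exact ⟨fun ⟨o, h1, h2⟩ => ⟨o, h2, h1⟩, fun ⟨o, h1, h2⟩ => ⟨o, h2, h1⟩⟩
    rw [this]
    exact isOpen_biUnion fun o _ => hE o)
  refine ⟨(fun o => Subtype.val ⁻¹' E o) '' (g '' K), ⟨?_, eq_univ_of_forall fun x => ?_⟩, ?_,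
    Cardinal.mk_image_le.trans_lt hcard⟩
  · rintro _ ⟨o, -, rfl⟩
    exact (hE o).preimage continuous_subtype_val
  · exact ⟨_, ⟨_, ⟨x, x.2, rfl⟩, rfl⟩, hg x⟩
  · rintro _ ⟨_, ⟨x, hx, rfl⟩, rfl⟩
    have hgx : x ∈ E (g x) := hg x
    rcases hgU : g x with _ | U
    · rw [hgU] at hgx
      exact absurd hx hgx
    · exact ⟨U, U.2, (hO U).subset⟩

theorem isCompletelyMetrizableSpace_of_discrete (Y : Type u) [TopologicalSpace Y]
    [DiscreteTopology Y] : TopologicalSpace.IsCompletelyMetrizableSpace Y := by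
  let _ : UniformSpace Y := ⊥
  have : DiscreteUniformity Y := ⟨rfl⟩
  obtain rfl : ‹TopologicalSpace Y› = UniformSpace.toTopologicalSpace := by
    rw [DiscreteTopology.eq_bot (α := Y),
      DiscreteTopology.eq_bot (t := UniformSpace.toTopologicalSpace)]
  infer_instance

end Selections

theorem theorem3p1 (X : Type u) [TopologicalSpace X] [T1Space X]
    (τ : Cardinal.{u}) (hτ : ℵ₀ < τ) (hseq : ¬ IsSequential τ) :
    List.TFAE [
      -- (1)
      (T2Space X ∧ ParacompactSpace X) ∧ compactnessDegree (cozeroKernel X) ≤ τ,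
      -- (2)
      (T2Space X ∧ ParacompactSpace X) ∧
        ∀ (Y : Type u) [TopologicalSpace Y] [TopologicalSpace.IsCompletelyMetrizableSpace Y]
          (θ : SetValuedMap X Y), θ.IsLSC → θ.ClosedValued →
          ∃ φ : SetValuedMap X Y, φ.IsSelection θ ∧ φ.IsLSC ∧
            weight (φ.image (cozeroKernel X)) < τ,
      -- (3)
      (T2Space X ∧ ParacompactSpace X) ∧
        ∀ (Y : Type u) [TopologicalSpace Y] [TopologicalSpace.IsCompletelyMetrizableSpace Y]
          (θ : SetValuedMap X Y), θ.IsLSC → θ.ClosedValued →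
          ∃ g : X → Y, SetValuedMap.IsSingleValuedSelection g θ ∧
            weight (g '' cozeroKernel X) < τ,
      -- (4)
      (T2Space X ∧ ParacompactSpace X) ∧
        ∀ (Y : Type u) [TopologicalSpace Y] [DiscreteTopology Y]
          (θ : SetValuedMap X Y), θ.IsLSC →
          ∃ g : X → Y, SetValuedMap.IsSingleValuedSelection g θ ∧
            #(g '' cozeroKernel X) < τ,
      -- (5)
      ∀ (Y : Type u) [TopologicalSpace Y] [TopologicalSpace.IsCompletelyMetrizableSpace Y]
        (θ : SetValuedMap X Y), θ.IsLSC → θ.ClosedValued →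
        ∃ φ ψ : SetValuedMap X Y,
          φ.CompactValued ∧ φ.IsLSC ∧ ψ.CompactValued ∧ ψ.IsUSC ∧
          weight (ψ.image (cozeroKernel X)) < τ ∧
          ∀ x : X, φ x ⊆ ψ x ∧ ψ x ⊆ θ x,
      -- (5')
      (T2Space X ∧ ParacompactSpace X) ∧
        ∀ (Y : Type u) [TopologicalSpace Y] [TopologicalSpace.IsCompletelyMetrizableSpace Y]
          (θ : SetValuedMap X Y), θ.IsLSC → θ.ClosedValued →
          ∃ φ ψ : SetValuedMap X Y,
            φ.CompactValued ∧ φ.IsLSC ∧ ψ.CompactValued ∧ ψ.IsUSC ∧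
            weight (ψ.image univ) < τ ∧
            ∀ x ∈ cozeroKernel X, φ x ⊆ ψ x ∧ ψ x ⊆ θ x,
      -- (6)
      ∀ (Y : Type u) [MetricSpace Y] [CompleteSpace Y]
        (θ : SetValuedMap X Y), θ.IsLSC → θ.ClosedValued →
        ∃ (H : Set X) (ψ : SetValuedMap X Y), IsClosed H ∧ IsGδ H ∧
          ψ.IsSelection θ ∧ ψ.IsUSC ∧ ψ.CompactValued ∧
          (cozeroKernel X ⊆ H ∧ weight (ψ.image H) < τ) ∧
          (∀ x ∈ Hᶜ, ∃ y : Y, ψ x = {y}) ∧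
          closure (ψ.image H) = closure (ψ.image (cozeroKernel X)),
      -- (7)
      ∀ (Y : Type u) [MetricSpace Y] [CompleteSpace Y]
        (θ : SetValuedMap X Y), θ.IsLSC → θ.ClosedValued →
        ∃ ψ : SetValuedMap X Y, ψ.IsSelection θ ∧ ψ.IsUSC ∧ ψ.CompactValued ∧
          ∀ x : X, compactnessDegree (ψ.largestImage {x}) ≤ τ,
      -- (8)
      ∀ (Y : Type u) [TopologicalSpace Y] [DiscreteTopology Y]
        (θ : SetValuedMap X Y), θ.IsLSC →
        ∃ ψ : SetValuedMap X Y, ψ.IsSelection θ ∧ ψ.IsUSC ∧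
          ∀ x : X, #(ψ.largestImage {x}) < τ] ∧
    -- for a limit cardinal, (1) is also equivalent to (7) with a strict inequality
    (Order.IsSuccLimit τ →
      ((T2Space X ∧ ParacompactSpace X) ∧ compactnessDegree (cozeroKernel X) ≤ τ ↔
        ∀ (Y : Type u) [MetricSpace Y] [CompleteSpace Y]
          (θ : SetValuedMap X Y), θ.IsLSC → θ.ClosedValued →
          ∃ ψ : SetValuedMap X Y, ψ.IsSelection θ ∧ ψ.IsUSC ∧ ψ.CompactValued ∧
            ∀ x : X, compactnessDegree (ψ.largestImage {x}) < τ)) := by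
  have hdisc : ∀ (Y : Type u) [TopologicalSpace Y] [DiscreteTopology Y] (θ : SetValuedMap X Y),
      θ.ClosedValued := fun Y _ _ θ x => isClosed_discrete _
  have hmono : ∀ {Y : Type u} [TopologicalSpace Y] [DiscreteTopology Y] {g : X → Y} {S : Set Y},
      weight S < τ → MapsTo g (cozeroKernel X) S → #(g '' cozeroKernel X) < τ := by
    intro Y _ _ g S hS hg
    exact (mk_le_weight.trans (weight_mono hg.image_subset)).trans_lt hS
  have hconverse : (∀ (Y : Type u) [TopologicalSpace Y] [DiscreteTopology Y]
        (θ : SetValuedMap X Y), θ.IsLSC →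
        ∃ ψ : SetValuedMap X Y, ψ.IsSelection θ ∧ ψ.IsUSC ∧
          ∀ x : X, #(ψ.largestImage {x}) < τ) →
      (T2Space X ∧ ParacompactSpace X) ∧ compactnessDegree (cozeroKernel X) ≤ τ := by
    intro h
    have hX := t2Space_and_paracompactSpace_of_usc_selection (X := X) fun Y _ _ θ hθ => by
      obtain ⟨ψ, h1, h2, -⟩ := h Y θ hθ
      exact ⟨ψ, h1, h2⟩
    obtain ⟨_, _⟩ := hX
    exact ⟨⟨‹_›, ‹_›⟩, compactnessDegree_le_of_forall_discrete hτ isClosed_cozeroKernel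
      fun D hDK hD => mk_lt_of_usc_selection (Cardinal.aleph0_pos.trans hτ) hDK hD h⟩
  have hdiscrete : (∀ (Y : Type u) [MetricSpace Y] [CompleteSpace Y]
        (θ : SetValuedMap X Y), θ.IsLSC → θ.ClosedValued →
        ∃ ψ : SetValuedMap X Y, ψ.IsSelection θ ∧ ψ.IsUSC ∧ ψ.CompactValued ∧
          ∀ x : X, compactnessDegree (ψ.largestImage {x}) ≤ τ) →
      ∀ (Y : Type u) [TopologicalSpace Y] [DiscreteTopology Y]
        (θ : SetValuedMap X Y), θ.IsLSC →
        ∃ ψ : SetValuedMap X Y, ψ.IsSelection θ ∧ ψ.IsUSC ∧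
          ∀ x : X, #(ψ.largestImage {x}) < τ := by
    intro h Y _ _ θ hθ
    have := isCompletelyMetrizableSpace_of_discrete Y
    let _ := TopologicalSpace.upgradeIsCompletelyMetrizable Y
    obtain ⟨ψ, h1, h2, -, h4⟩ := h Y θ hθ (hdisc Y θ)
    exact ⟨ψ, h1, h2, fun x => mk_lt_compactnessDegree.trans_le (h4 x)⟩
  refine ⟨?_, fun hlim => ⟨?_, fun h => hconverse (hdiscrete fun Y _ _ θ hθ hc => ?_)⟩⟩
  · tfae_have 1 → 2 := by
      rintro ⟨⟨_, _⟩, hK⟩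
      refine ⟨⟨‹_›, ‹_›⟩, fun Y _ _ θ hθ hc => ?_⟩
      let _ := TopologicalSpace.upgradeIsCompletelyMetrizable Y
      obtain ⟨φ, ψ, -, hφ, -, -, hsub, D, hD, hψD⟩ :=
        exists_selections_small_on_cozeroKernel hτ hseq hK θ hθ hc
      exact ⟨φ, fun x => (hsub x).1.trans (hsub x).2, hφ,
        weight_lt_of_subset_closure hτ ((iUnion₂_mono fun x _ => (hsub x).1).trans hψD) hD⟩
    tfae_have 2 → 3 := by
      rintro ⟨hX, h⟩
      refine ⟨hX, fun Y _ _ θ hθ hc => ?_⟩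
      obtain ⟨φ, hsel, -, hw⟩ := h Y θ hθ hc
      choose g hg using φ.nonempty'
      refine ⟨g, fun x => hsel x (hg x), (weight_mono ?_).trans_lt hw⟩
      rintro _ ⟨x, hx, rfl⟩
      exact mem_biUnion hx (hg x)
    tfae_have 3 → 4 := by
      rintro ⟨hX, h⟩
      refine ⟨hX, fun Y _ _ θ hθ => ?_⟩
      have := isCompletelyMetrizableSpace_of_discrete Y
      obtain ⟨g, hg, hw⟩ := h Y θ hθ (hdisc Y θ)
      exact ⟨g, hg, hmono hw (mapsTo_image _ _)⟩
    tfae_have 4 → 1 := by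
      rintro ⟨hX, h⟩
      exact ⟨hX, compactnessDegree_le_of_discrete_selection isClosed_cozeroKernel h⟩
    tfae_have 1 → 5 := by
      rintro ⟨⟨_, _⟩, hK⟩ Y _ _ θ hθ hc
      let _ := TopologicalSpace.upgradeIsCompletelyMetrizable Y
      obtain ⟨φ, ψ, hφc, hφ, hψc, hψ, hsub, D, hD, hψD⟩ :=
        exists_selections_small_on_cozeroKernel hτ hseq hK θ hθ hc
      exact ⟨φ, ψ, hφc, hφ, hψc, hψ, weight_lt_of_subset_closure hτ hψD hD, hsub⟩
    tfae_have 5 → 4 := by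
      intro h
      refine ⟨t2Space_and_paracompactSpace_of_usc_selection fun Y _ _ θ hθ => ?_,
        fun Y _ _ θ hθ => ?_⟩
      · have := isCompletelyMetrizableSpace_of_discrete Y
        obtain ⟨_, ψ, -, -, -, hψ, -, hsub⟩ := h Y θ hθ (hdisc Y θ)
        exact ⟨ψ, fun x => (hsub x).2, hψ⟩
      · have := isCompletelyMetrizableSpace_of_discrete Y
        obtain ⟨_, ψ, -, -, -, -, hw, hsub⟩ := h Y θ hθ (hdisc Y θ)
        choose g hg using ψ.nonempty'
        exact ⟨g, fun x => (hsub x).2 (hg x), hmono hw fun x hx => mem_biUnion hx (hg x)⟩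
    tfae_have 1 → 6 := by
      rintro ⟨⟨_, _⟩, hK⟩
      refine ⟨⟨‹_›, ‹_›⟩, fun Y _ _ θ hθ hc => ?_⟩
      let _ := TopologicalSpace.upgradeIsCompletelyMetrizable Y
      exact exists_selections_of_small_image hτ hseq hK θ hθ hc
    tfae_have 6 → 4 := by
      classical
      rintro ⟨hX, h⟩
      refine ⟨hX, fun Y _ _ θ hθ => ?_⟩
      have := isCompletelyMetrizableSpace_of_discrete Y
      obtain ⟨_, ψ, -, -, -, -, hw, hsub⟩ := h Y θ hθ (hdisc Y θ)
      choose g hg using ψ.nonempty'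
      choose g' hg' using θ.nonempty'
      refine ⟨fun x => if x ∈ cozeroKernel X then g x else g' x, fun x => ?_,
        hmono hw fun x hx => ?_⟩
      · beta_reduce
        split_ifs with hx
        · exact (hsub x hx).2 (hg x)
        · exact hg' x
      · rw [if_pos hx]
        exact mem_biUnion (mem_univ x) (hg x)
    tfae_have 1 → 7 := by
      rintro ⟨⟨_, _⟩, hK⟩ Y _ _ θ hθ hc
      exact exists_usc_selection_single_valued_off hτ hseq hK θ hθ hc
    tfae_have 7 → 8 := by
      intro h Y _ _ θ hθ hc
      obtain ⟨H, ψ, -, -, hsel, hψ, hψc, ⟨-, hw⟩, hsing, -⟩ := h Y θ hθ hc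
      refine ⟨ψ, hsel, hψ, hψc, fun x => ?_⟩
      obtain ⟨m, hm, hle⟩ := compactnessDegree_largestImage_le hτ hw hsing x
      exact hle.trans (Order.succ_le_of_lt hm)
    tfae_have 8 → 9 := hdiscrete
    tfae_have 9 → 1 := hconverse
    tfae_finish
  · rintro ⟨⟨_, _⟩, hK⟩ Y _ _ θ hθ hc
    obtain ⟨H, ψ, -, -, hsel, hψ, hψc, ⟨-, hw⟩, hsing, -⟩ :=
      exists_usc_selection_single_valued_off hτ hseq hK θ hθ hc
    refine ⟨ψ, hsel, hψ, hψc, fun x => ?_⟩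
    obtain ⟨m, hm, hle⟩ := compactnessDegree_largestImage_le hτ hw hsing x
    exact hle.trans_lt (hlim.succ_lt hm)
  · obtain ⟨ψ, h1, h2, h3, h4⟩ := h Y θ hθ hc
    exact ⟨ψ, h1, h2, h3, fun x => (h4 x).le⟩
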